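/- **Proposition 3.5 (Stokes' theorem).** Let $m\ge 1$ and let $M$ be a connected, oriented, smooth ($C^\infty$) manifold with corners of dimension $m$, i.e. a connected, second countable Hausdorff space with a smooth atlas of charts onto open subsets of the quadrant $Q^m=\{x\in\mathbb R^m: x_i\ge 0 \text{ for all } i\}$, with a continuous choice of orientations of the tangent spaces. Let $\partial^1 M$ be the set of all corners of codimension $1$, that is, of all points of $M$ that lie, in a chart, on exactly one of the coordinate hyperplanes $\{x_i=0\}$. It is a smooth manifold without boundary of dimension $m-1$ (possibly empty, disconnected or non-compact); we give it the boundary orientation (outward normal first), and we write $j_{\partial^1M}\colon\partial^1M\to M$ for the inclusion. Then for every smooth differential form $\omega\in\Omega^{m-1}_c(M)$ of degree $m-1$ with compact support in $M$, the form $d\omega$ is absolutely integrable over $M$, the form $j_{\partial^1M}^*\omega$ (whose support in $\partial^1M$ need not be compact) is absolutely integrable over $\partial^1M$, and $$\int_M d\omega=\int_{\partial^1M}j_{\partial^1M}^*\omega .$$ For $m=1$ the manifold $\partial^1M$ is discrete, its orientation is a choice of signs, and the right-hand side is the finite sum of the values of $\omega$ at the points of $\partial^1 M$, taken with these signs. 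-/

import Mathlib

open Set Filter Topology MeasureTheory
open scoped Manifold ContDiff

noncomputable section

namespace CornerStokes

/-! ### Differential forms on a manifold (possibly with boundary or corners) -/

section Forms

variable {E : Type*} [NormedAddCommGroup E] [NormedSpace ℝ E]
  {H : Type*} [TopologicalSpace H] (I : ModelWithCorners ℝ E H)
  {E' : Type*} [NormedAddCommGroup E'] [NormedSpace ℝ E']
  {H' : Type*} [TopologicalSpace H'] (I' : ModelWithCorners ℝ E' H')
  {M : Type*} [TopologicalSpace M] [ChartedSpace H M]
  {N : Type*} [TopologicalSpace N] [ChartedSpace H' N]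

variable (M) in
/-- A (not necessarily smooth) field of alternating `k`-linear forms on the tangent spaces. -/
abbrev DiffForm (k : ℕ) : Type _ := ∀ x : M, TangentSpace I x [⋀^Fin k]→L[ℝ] ℝ

/-- The differential at `y` of the inverse of the (extended) chart `e`. -/
def dChartSymm (e : OpenPartialHomeomorph M H) (y : E) :
    E →L[ℝ] TangentSpace I ((e.extend I).symm y) :=
  mfderivWithin 𝓘(ℝ, E) I (e.extend I).symm (range I) y

/-- The form `α` in the chart `e`: its pullback along the inverse of the chart.
It is meaningful on `(e.extend I).target`. -/
def chartRep {k : ℕ} (e : OpenPartialHomeomorph M H) (α : DiffForm I M k) (y : E) :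
    E [⋀^Fin k]→L[ℝ] ℝ :=
  (α ((e.extend I).symm y)).compContinuousLinearMap (dChartSymm I e y)

/-- `α` is a smooth form: it is smooth in every chart of the atlas. -/
def SmoothForm {k : ℕ} (α : DiffForm I M k) : Prop :=
  ∀ e ∈ atlas H M, ContDiffOn ℝ ∞ (chartRep I e α) (e.extend I).target

/-- The support (the closure of the set where `α` does not vanish) is compact. -/
def CompactlySupported {k : ℕ} (α : DiffForm I M k) : Prop :=
  IsCompact (closure {x : M | α x ≠ 0})

/-- The exterior derivative: at `x` it is computed in the preferred chart around `x`
(any other chart around `x` gives the same value, as `d` commutes with pullbacks). -/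
def extDer {k : ℕ} (α : DiffForm I M k) : DiffForm I M (k + 1) := fun x =>
  (extDerivWithin (chartRep I (chartAt H x) α) (range I)
    (extChartAt I x x)).compContinuousLinearMap (mfderiv I 𝓘(ℝ, E) (extChartAt I x) x)

/-- The pullback `f^* α` of a form along a smooth map `f`. -/
def pullback {k : ℕ} (f : N → M) (α : DiffForm I M k) : DiffForm I' N k := fun x =>
  (α (f x)).compContinuousLinearMap (mfderiv I' I f x)

end Forms

/-! ### Orientations and integrals of forms of top degree -/

section Integration

variable {k : ℕ} {H : Type*} [TopologicalSpace H]
  (I : ModelWithCorners ℝ (EuclideanSpace ℝ (Fin k)) H)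
  {N : Type*} [TopologicalSpace N] [ChartedSpace H N]

/-- The sign of a `k`-tuple of vectors with respect to an orientation. -/
def frameSign {V : Type*} [AddCommGroup V] [Module ℝ V] (o : Orientation ℝ V (Fin k))
    (v : Fin k → V) : SignType :=
  SignType.sign (o.someVector v)

/-- The standard basis of `ℝ^k`. -/
def stdFrame (k : ℕ) : Fin k → EuclideanSpace ℝ (Fin k) := fun i => EuclideanSpace.single i 1

variable (N) in
/-- A choice of an orientation of each tangent space. -/
abbrev PointwiseOrientation : Type _ := ∀ x : N, Orientation ℝ (TangentSpace I x) (Fin k)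

/-- The pointwise orientation `o` is an orientation of the manifold: in each chart of the atlas,
the sign of the coordinate frame is locally constant. -/
def IsOrientation (o : PointwiseOrientation I N) : Prop :=
  ∀ e ∈ atlas H N, ∀ y ∈ (e.extend I).target, ∀ᶠ z in 𝓝[(e.extend I).target] y,
    frameSign (o ((e.extend I).symm z)) (fun i => dChartSymm I e z (stdFrame k i)) =
      frameSign (o ((e.extend I).symm y)) (fun i => dChartSymm I e y (stdFrame k i))

open Classical in
/-- The sign of the form `η` of top degree at `x` relative to the orientation `o`: `0` if `η`
vanishes at `x`, `1` if `η x` is a positive multiple of the alternating forms that define `o x`,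
and `-1` if it is a negative multiple (the space of these forms is one-dimensional). -/
def formSign (o : PointwiseOrientation I N) (η : DiffForm I N k) (x : N) : ℝ :=
  if η x = 0 then 0
  else if SameRay ℝ (o x).someVector (η x).toAlternatingMap then 1 else -1

variable [MeasurableSpace N]

/-- The Borel measure on the domain of the chart `e` with density `|η|`: in the
coordinates of `e` it is `|η(∂₁, …, ∂ₖ)|` times the Lebesgue measure. -/
def chartMeasure (η : DiffForm I N k) (e : OpenPartialHomeomorph N H) : Measure N :=
  Measure.map (e.extend I).symm
    ((volume.restrict (e.extend I).target).withDensity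
      fun y => ENNReal.ofReal |chartRep I e η y (stdFrame k)|)

/-- The measure `|η|` on `N`. By the change of variables formula the measures
`chartMeasure I η e` agree on the overlaps of the charts, and their least upper bound in the
lattice of measures is the measure on `N` that restricts to each of them. -/
def formMeasure (η : DiffForm I N k) : Measure N :=
  ⨆ e ∈ atlas H N, chartMeasure I η e

/-- The form `η` of top degree is absolutely integrable. -/
def IntegrableForm (o : PointwiseOrientation I N) (η : DiffForm I N k) : Prop :=
  Integrable (formSign I o η) (formMeasure I η)

/-- The integral of the form `η` of top degree over `N` with the orientation `o`. -/
def formIntegral (o : PointwiseOrientation I N) (η : DiffForm I N k) : ℝ :=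
  ∫ x, formSign I o η x ∂(formMeasure I η)

end Integration

/-! ### Manifolds with corners and their strata -/

section Strata

/-- The model of the manifolds with corners of dimension `m`: the quadrant in `ℝ^m`. -/
abbrev QModel (m : ℕ) :
    ModelWithCorners ℝ (EuclideanSpace ℝ (Fin m)) (EuclideanQuadrant m) :=
  modelWithCornersEuclideanQuadrant m

/-- The corners of codimension `q`: the points that lie, in a chart, on exactly `q` of the
coordinate hyperplanes (`q` does not depend on the chart). -/
def stratum (m : ℕ) (M : Type*) [TopologicalSpace M] [ChartedSpace (EuclideanQuadrant m) M]
    (q : ℕ) : Set M :=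
  {x | ∃ e ∈ atlas (EuclideanQuadrant m) M, x ∈ e.source ∧
    (Finset.univ.filter fun i : Fin m => (e x).1 i = 0).card = q}

variable {n : ℕ}

/-- The inclusion of `ℝ^n` in `ℝ^(n+1)` as the hyperplane where the `i`-th coordinate is zero. -/
def faceIncl (i : Fin (n + 1)) :
    EuclideanSpace ℝ (Fin n) →L[ℝ] EuclideanSpace ℝ (Fin (n + 1)) :=
  LinearMap.toContinuousLinearMap
    { toFun := fun u => WithLp.toLp 2 (i.insertNth (0 : ℝ) (fun j => u j))
      map_add' := by
        intro u v
        ext j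
        refine Fin.succAboveCases i ?_ (fun j => ?_) j <;> simp
      map_smul' := by
        intro c u
        ext j
        refine Fin.succAboveCases i ?_ (fun j => ?_) j <;> simp }

/-- The projection of `ℝ^(n+1)` to `ℝ^n` that drops the `i`-th coordinate. -/
def faceProj (i : Fin (n + 1)) :
    EuclideanSpace ℝ (Fin (n + 1)) →L[ℝ] EuclideanSpace ℝ (Fin n) :=
  LinearMap.toContinuousLinearMap
    { toFun := fun v => WithLp.toLp 2 (fun j => v (i.succAbove j))
      map_add' := by intro u v; ext j; simp
      map_smul' := by intro c u; ext j; simp }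

@[simp] theorem faceIncl_same (i : Fin (n + 1)) (u : EuclideanSpace ℝ (Fin n)) :
    faceIncl i u i = 0 := by
  simp [faceIncl]

@[simp] theorem faceIncl_succAbove (i : Fin (n + 1)) (u : EuclideanSpace ℝ (Fin n)) (j : Fin n) :
    faceIncl i u (i.succAbove j) = u j := by
  simp [faceIncl]

@[simp] theorem faceProj_apply (i : Fin (n + 1)) (v : EuclideanSpace ℝ (Fin (n + 1))) (j : Fin n) :
    faceProj i v j = v (i.succAbove j) := by
  simp [faceProj]

theorem faceProj_faceIncl (i : Fin (n + 1)) (u : EuclideanSpace ℝ (Fin n)) :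
    faceProj i (faceIncl i u) = u := by
  ext j; simp

theorem faceIncl_faceProj (i : Fin (n + 1)) (v : EuclideanSpace ℝ (Fin (n + 1))) (h : v i = 0) :
    faceIncl i (faceProj i v) = v := by
  ext j
  refine Fin.succAboveCases i ?_ (fun j => ?_) j <;> simp [h]

variable {M : Type*} [TopologicalSpace M] [ChartedSpace (EuclideanQuadrant (n + 1)) M]

/-- `e` is a chart around `x` in which `x` lies on the `i`-th coordinate hyperplane and on
no other one. -/
structure IsFaceChart (e : OpenPartialHomeomorph M (EuclideanQuadrant (n + 1)))
    (i : Fin (n + 1)) (x : M) : Prop where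
  mem_atlas : e ∈ atlas (EuclideanQuadrant (n + 1)) M
  mem_source : x ∈ e.source
  eq_zero_iff : ∀ j, (e x).1 j = 0 ↔ j = i

theorem exists_isFaceChart {x : M} (hx : x ∈ stratum (n + 1) M 1) :
    ∃ (e : OpenPartialHomeomorph M (EuclideanQuadrant (n + 1))) (i : Fin (n + 1)),
      IsFaceChart e i x := by
  obtain ⟨e, he, hxe, hc⟩ := hx
  obtain ⟨i, hi⟩ := Finset.card_eq_one.1 hc
  refine ⟨e, i, he, hxe, fun j => ?_⟩
  have := Finset.ext_iff.1 hi j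
  simpa using this

theorem IsFaceChart.mem_stratum {e : OpenPartialHomeomorph M (EuclideanQuadrant (n + 1))}
    {i : Fin (n + 1)} {x : M} (h : IsFaceChart e i x) : x ∈ stratum (n + 1) M 1 := by
  refine ⟨e, h.mem_atlas, h.mem_source, Finset.card_eq_one.2 ⟨i, ?_⟩⟩
  ext j
  simpa using h.eq_zero_iff j

theorem range_qModel (m : ℕ) :
    range (QModel m) = {y : EuclideanSpace ℝ (Fin m) | ∀ i, 0 ≤ y i} :=
  range_euclideanQuadrant m

theorem interior_range_qModel (m : ℕ) :
    interior (range (QModel m)) = {y : EuclideanSpace ℝ (Fin m) | ∀ i, 0 < y i} := by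
  rw [range_qModel]
  exact interior_euclideanQuadrant m 2 0

/-- A corner of codimension `1` is a boundary point in every chart. -/
theorem eq_zero_of_mem_stratum [IsManifold (QModel (n + 1)) ∞ M]
    {x : M} (hx : x ∈ stratum (n + 1) M 1)
    {e : OpenPartialHomeomorph M (EuclideanQuadrant (n + 1))}
    (he : e ∈ atlas (EuclideanQuadrant (n + 1)) M) (hxe : x ∈ e.source) {i : Fin (n + 1)}
    (hi : ∀ j : Fin n, 0 < (e x).1 (i.succAbove j)) : (e x).1 i = 0 := by
  by_contra h
  obtain ⟨e', i', h'⟩ := exists_isFaceChart hx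
  have hpos : ∀ j, 0 < (e x).1 j := fun j =>
    Fin.succAboveCases i (lt_of_le_of_ne ((e x).2 i) (Ne.symm h)) hi j
  have hint : e.extend (QModel (n + 1)) x ∈ interior (e.extend (QModel (n + 1))).target := by
    refine e.mem_interior_extend_target (e.map_source hxe) ?_
    rw [interior_range_qModel]
    exact hpos
  rw [(QModel (n + 1)).mem_interior_range_iff_of_mem_atlas (n := ∞) (by simp) he h'.mem_atlas hxe
    h'.mem_source] at hint
  have h2 : e'.extend (QModel (n + 1)) x ∈ interior (range (QModel (n + 1))) :=
    interior_mono (by rw [e'.extend_target]; exact inter_subset_right) hint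
  rw [interior_range_qModel] at h2
  have h3 := h2 i'
  have h4 : (e' x).1 i' = 0 := (h'.eq_zero_iff i').2 rfl
  exact h3.ne' h4

/-- The domain in `ℝ^n` of the `i`-th face in the chart `e`. -/
def faceTarget (e : OpenPartialHomeomorph M (EuclideanQuadrant (n + 1))) (i : Fin (n + 1)) :
    Set (EuclideanSpace ℝ (Fin n)) :=
  {u | (∀ j, 0 < u j) ∧ faceIncl i u ∈ (e.extend (QModel (n + 1))).target}

theorem isFaceChart_of_mem_faceTarget {e : OpenPartialHomeomorph M (EuclideanQuadrant (n + 1))}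
    (he : e ∈ atlas (EuclideanQuadrant (n + 1)) M)
    {i : Fin (n + 1)} {u : EuclideanSpace ℝ (Fin n)} (hu : u ∈ faceTarget e i) :
    IsFaceChart e i ((e.extend (QModel (n + 1))).symm (faceIncl i u)) := by
  have hs := (e.extend (QModel (n + 1))).map_target hu.2
  have hr : (e ((e.extend (QModel (n + 1))).symm (faceIncl i u))).1 = faceIncl i u :=
    (e.extend (QModel (n + 1))).right_inv hu.2
  rw [e.extend_source] at hs
  refine ⟨he, hs, fun j => ?_⟩
  rw [hr]
  refine Fin.succAboveCases i ?_ (fun j => ?_) j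
  · simp
  · simp [(hu.1 j).ne']

variable [IsManifold (QModel (n + 1)) ∞ M]

open Classical in
/-- The chart of the stratum `∂¹M` that the chart `e` of `M` induces on its `i`-th face:
it drops the `i`-th coordinate, which vanishes there. The point `x₀` is only
used as the value of the inverse outside its domain. -/
def faceChart (e : OpenPartialHomeomorph M (EuclideanQuadrant (n + 1))) (i : Fin (n + 1))
    (x₀ : stratum (n + 1) M 1) (he : e ∈ atlas (EuclideanQuadrant (n + 1)) M) :
    OpenPartialHomeomorph (stratum (n + 1) M 1) (EuclideanSpace ℝ (Fin n)) where
  toFun y := faceProj i (e y.1).1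
  invFun u := if h : u ∈ faceTarget e i then
      ⟨(e.extend (QModel (n + 1))).symm (faceIncl i u),
        (isFaceChart_of_mem_faceTarget he h).mem_stratum⟩
    else x₀
  source := {y | y.1 ∈ e.source ∧ ∀ j : Fin n, 0 < (e y.1).1 (i.succAbove j)}
  target := faceTarget e i
  map_source' := by
    rintro y ⟨hy, hpos⟩
    refine ⟨fun j => by simpa using hpos j, ?_⟩
    rw [faceIncl_faceProj i _ (eq_zero_of_mem_stratum y.2 he hy hpos)]
    exact (e.extend (QModel (n + 1))).map_source (by rwa [e.extend_source])
  map_target' := by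
    intro u hu
    have h := isFaceChart_of_mem_faceTarget he hu
    have hr : (e ((e.extend (QModel (n + 1))).symm (faceIncl i u))).1 = faceIncl i u :=
      (e.extend (QModel (n + 1))).right_inv hu.2
    simp only [hu, dite_true]
    refine ⟨h.mem_source, fun j => ?_⟩
    simp only [hr]
    simpa using hu.1 j
  left_inv' := by
    rintro y ⟨hy, hpos⟩
    have h0 := faceIncl_faceProj i _ (eq_zero_of_mem_stratum y.2 he hy hpos)
    have hu : faceProj i (e y.1).1 ∈ faceTarget e i := by
      refine ⟨fun j => by simpa using hpos j, ?_⟩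
      rw [h0]
      exact (e.extend (QModel (n + 1))).map_source (by rwa [e.extend_source])
    simp only [hu, dite_true]
    apply Subtype.ext
    simp only [h0]
    exact (e.extend (QModel (n + 1))).left_inv (by rwa [e.extend_source])
  right_inv' := by
    intro u hu
    have hr : (e ((e.extend (QModel (n + 1))).symm (faceIncl i u))).1 = faceIncl i u :=
      (e.extend (QModel (n + 1))).right_inv hu.2
    simp only [hu, dite_true]
    rw [hr, faceProj_faceIncl]
  open_source := by
    rw [isOpen_iff_mem_nhds]
    rintro y ⟨hy, hpos⟩
    have hc : ContinuousAt (fun z : stratum (n + 1) M 1 => (e z.1).1) y :=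
      continuous_subtype_val.continuousAt.comp
        ((e.continuousAt hy).comp continuous_subtype_val.continuousAt)
    have h1 : ∀ᶠ z : stratum (n + 1) M 1 in 𝓝 y, z.1 ∈ e.source :=
      continuous_subtype_val.continuousAt (e.open_source.mem_nhds hy)
    have h2 : ∀ᶠ z : stratum (n + 1) M 1 in 𝓝 y, ∀ j : Fin n, 0 < (e z.1).1 (i.succAbove j) := by
      rw [eventually_all]
      intro j
      have hcj : ContinuousAt (fun z : stratum (n + 1) M 1 => (e z.1).1 (i.succAbove j)) y :=
        (PiLp.continuous_apply 2 _ (i.succAbove j)).continuousAt.comp hc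
      exact hcj (Ioi_mem_nhds (hpos j))
    filter_upwards [h1, h2] with z hz1 hz2 using ⟨hz1, hz2⟩
  open_target := by
    have : faceTarget e i = {u | ∀ j, 0 < u j} ∩
        (fun u => (QModel (n + 1)).symm (faceIncl i u)) ⁻¹' e.target := by
      ext u
      simp only [faceTarget, e.extend_target, mem_inter_iff, mem_preimage]
      constructor
      · rintro ⟨h1, h2, h3⟩
        exact ⟨h1, h2⟩
      · rintro ⟨h1, h2⟩
        refine ⟨h1, h2, ?_⟩
        rw [range_qModel]
        intro j
        refine Fin.succAboveCases i ?_ (fun j => ?_) j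
        · simp
        · simpa using (h1 j).le
    rw [this]
    refine IsOpen.inter ?_ (e.open_target.preimage
      ((QModel (n + 1)).continuous_symm.comp (faceIncl i).continuous))
    have : {u : EuclideanSpace ℝ (Fin n) | ∀ j, 0 < u j} = ⋂ j, {u | 0 < u j} := by
      ext; simp
    rw [this]
    exact isOpen_iInter_of_finite fun j =>
      isOpen_lt continuous_const (PiLp.continuous_apply 2 _ j)
  continuousOn_toFun := by
    refine (faceProj i).continuous.comp_continuousOn (continuous_subtype_val.comp_continuousOn ?_)
    exact e.continuousOn.comp continuous_subtype_val.continuousOn fun y hy => hy.1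
  continuousOn_invFun := by
    rw [continuousOn_iff_continuous_domRestrict]
    refine continuous_induced_rng.2 ?_
    have h : ContinuousOn (fun u => (e.extend (QModel (n + 1))).symm (faceIncl i u))
        (faceTarget e i) :=
      (e.continuousOn_extend_symm).comp (faceIncl i).continuous.continuousOn fun u hu => hu.2
    rw [continuousOn_iff_continuous_domRestrict] at h
    refine h.congr fun u => ?_
    simp

/-- The stratum `∂¹M` as a manifold of dimension `n`, with the charts that the charts of `M`
induce on their faces. -/
instance : ChartedSpace (EuclideanSpace ℝ (Fin n)) (stratum (n + 1) M 1) where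
  atlas := {c | ∃ (e : OpenPartialHomeomorph M (EuclideanQuadrant (n + 1))) (i : Fin (n + 1))
    (x₀ : stratum (n + 1) M 1) (he : e ∈ atlas (EuclideanQuadrant (n + 1)) M),
      c = faceChart e i x₀ he}
  chartAt x := faceChart (exists_isFaceChart x.2).choose (exists_isFaceChart x.2).choose_spec.choose
    x (exists_isFaceChart x.2).choose_spec.choose_spec.mem_atlas
  mem_chart_source x := by
    have h := (exists_isFaceChart x.2).choose_spec.choose_spec
    refine ⟨h.mem_source, fun j => lt_of_le_of_ne ((_ : EuclideanQuadrant (n + 1)).2 _) fun h0 => ?_⟩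
    exact Fin.succAbove_ne _ _ ((h.eq_zero_iff _).1 h0.symm)
  chart_mem_atlas x := ⟨_, _, _, _, rfl⟩

theorem faceChart_mem_atlas (e : OpenPartialHomeomorph M (EuclideanQuadrant (n + 1)))
    (i : Fin (n + 1)) (x₀ : stratum (n + 1) M 1)
    (he : e ∈ atlas (EuclideanQuadrant (n + 1)) M) :
    faceChart e i x₀ he ∈ atlas (EuclideanSpace ℝ (Fin n)) (stratum (n + 1) M 1) :=
  ⟨e, i, x₀, he, rfl⟩

theorem faceChart_symm_val (e : OpenPartialHomeomorph M (EuclideanQuadrant (n + 1)))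
    (i : Fin (n + 1)) (x₀ : stratum (n + 1) M 1)
    (he : e ∈ atlas (EuclideanQuadrant (n + 1)) M) {u : EuclideanSpace ℝ (Fin n)}
    (hu : u ∈ faceTarget e i) :
    ((faceChart e i x₀ he).symm u).1 = (e.extend (QModel (n + 1))).symm (faceIncl i u) := by
  have : (faceChart e i x₀ he).symm u = ⟨(e.extend (QModel (n + 1))).symm (faceIncl i u),
      (isFaceChart_of_mem_faceTarget he hu).mem_stratum⟩ := dif_pos hu
  rw [this]

/-- The stratum `∂¹M` is a smooth manifold without boundary. -/
instance : IsManifold (𝓡 n) ∞ (stratum (n + 1) M 1) := by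
  refine isManifold_of_contDiffOn _ _ _ ?_
  rintro _ _ ⟨e, i, x₀, he, rfl⟩ ⟨e', i', x₀', he', rfl⟩
  have h1 := (QModel (n + 1)).contDiffOn_extendCoordChange (n := ∞)
    (IsManifold.subset_maximalAtlas (I := QModel (n + 1)) he)
    (IsManifold.subset_maximalAtlas (I := QModel (n + 1)) he')
  have hmem : ∀ u ∈ ((𝓡 n).symm ⁻¹' ((faceChart e i x₀ he).symm ≫ₕ
      (faceChart e' i' x₀' he')).source ∩ range (𝓡 n)),
      u ∈ faceTarget e i ∧ (e.extend (QModel (n + 1))).symm (faceIncl i u) ∈ e'.source := by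
    rintro u ⟨hu, -⟩
    have hu1 : u ∈ faceTarget e i := hu.1
    have hu2 : ((faceChart e i x₀ he).symm u).1 ∈ e'.source := hu.2.1
    rw [faceChart_symm_val e i x₀ he hu1] at hu2
    exact ⟨hu1, hu2⟩
  refine ((faceProj i').contDiff.comp_contDiffOn
    (h1.comp (faceIncl i).contDiff.contDiffOn fun u hu => ?_)).congr fun u hu => ?_
  · obtain ⟨hu1, hu2⟩ := hmem u hu
    exact ⟨hu1.2, by simpa [e'.extend_source] using hu2⟩
  · obtain ⟨hu1, hu2⟩ := hmem u hu
    change faceProj i' (e' ((faceChart e i x₀ he).symm u).1).1 = _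
    rw [faceChart_symm_val e i x₀ he hu1]
    rfl

/-- The inclusion of the stratum `∂¹M` in `M`. -/
def incl (n : ℕ) (M : Type*) [TopologicalSpace M]
    [ChartedSpace (EuclideanQuadrant (n + 1)) M] (x : stratum (n + 1) M 1) : M := x.1

theorem IsFaceChart.mem_faceChart_source
    {e : OpenPartialHomeomorph M (EuclideanQuadrant (n + 1))} {i : Fin (n + 1)}
    {x : stratum (n + 1) M 1} (h : IsFaceChart e i x.1) :
    x ∈ (faceChart e i x h.mem_atlas).source :=
  ⟨h.mem_source, fun _ => lt_of_le_of_ne ((e x.1).2 _) fun h0 =>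
    Fin.succAbove_ne _ _ ((h.eq_zero_iff _).1 h0.symm)⟩

theorem contMDiff_incl : ContMDiff (𝓡 n) (QModel (n + 1)) ∞ (incl n M) := by
  intro x
  obtain ⟨e, i, h⟩ := exists_isFaceChart x.2
  set c := faceChart e i x h.mem_atlas with hc
  have hx : x ∈ c.source := h.mem_faceChart_source
  have hcx : c x ∈ faceTarget e i := c.map_source hx
  have h1 : ContMDiffAt (𝓡 n) (𝓡 n) ∞ c x :=
    contMDiffAt_of_mem_maximalAtlas
      (IsManifold.subset_maximalAtlas (faceChart_mem_atlas e i x h.mem_atlas)) hx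
  have h2 : ContMDiffWithinAt 𝓘(ℝ, EuclideanSpace ℝ (Fin (n + 1))) (QModel (n + 1)) ∞
      (e.extend (QModel (n + 1))).symm ((QModel (n + 1)) '' e.target) (faceIncl i (c x)) := by
    refine contMDiffOn_extend_symm (IsManifold.subset_maximalAtlas h.mem_atlas) _ ?_
    rw [← e.extend_target' (I := QModel (n + 1))]
    exact hcx.2
  have h3 : ContMDiffAt (𝓡 n) 𝓘(ℝ, EuclideanSpace ℝ (Fin (n + 1))) ∞
      (fun y => faceIncl i (c y)) x :=
    ((faceIncl i).contMDiff.contMDiffAt (x := c x)).comp x h1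
  have h4 : ContMDiffWithinAt (𝓡 n) (QModel (n + 1)) ∞
      (fun y => (e.extend (QModel (n + 1))).symm (faceIncl i (c y))) c.source x := by
    refine ContMDiffWithinAt.comp x h2 h3.contMDiffWithinAt fun y hy => ?_
    rw [← e.extend_target' (I := QModel (n + 1))]
    exact (c.map_source hy).2
  refine (h4.contMDiffAt (c.open_source.mem_nhds hx)).congr_of_eventuallyEq ?_
  filter_upwards [c.open_source.mem_nhds hx] with y hy
  have := faceChart_symm_val e i x h.mem_atlas (c.map_source hy)
  rw [← hc, c.left_inv hy] at this
  exact this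

end Strata

/-! ### The orientation of `∂¹M` as the boundary of `M` -/

section BoundaryOrientation

/-- The contraction of a nonzero form `φ` of top degree with a vector `ν` is nonzero on a
hyperplane, the image of `L`, that does not contain `ν`. -/
theorem contraction_ne_zero {n : ℕ} {V W : Type*} [AddCommGroup V] [Module ℝ V]
    [AddCommGroup W] [Module ℝ W] (hV : Module.finrank ℝ V = n + 1) (b : Module.Basis (Fin n) ℝ W)
    {φ : V [⋀^Fin (n + 1)]→ₗ[ℝ] ℝ} (hφ : φ ≠ 0) (L : W →ₗ[ℝ] V) (hL : Function.Injective L)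
    (l : V →ₗ[ℝ] ℝ) (hl : ∀ w, l (L w) = 0) {ν : V} (hν : l ν ≠ 0) :
    (φ.curryLeft ν).compLinearMap L ≠ 0 := by
  intro h
  have hli : LinearIndependent ℝ (Fin.cons ν (L ∘ b) : Fin (n + 1) → V) := by
    rw [linearIndependent_finCons]
    refine ⟨b.linearIndependent.map' L (LinearMap.ker_eq_bot.2 hL), fun hmem => hν ?_⟩
    have hle : Submodule.span ℝ (range (L ∘ b)) ≤ LinearMap.ker l := by
      rw [Submodule.span_le]
      rintro _ ⟨j, rfl⟩
      exact hl (b j)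
    exact hle hmem
  let B := basisOfLinearIndependentOfCardEqFinrank hli (by simp [hV])
  have hB : φ B ≠ 0 := (φ.map_basis_ne_zero_iff B).2 hφ
  apply hB
  have h2 : ((φ.curryLeft ν).compLinearMap L) b = 0 := by rw [h]; rfl
  have h3 : (B : Fin (n + 1) → V) = Fin.cons ν (L ∘ b) :=
    coe_basisOfLinearIndependentOfCardEqFinrank hli _
  rw [h3]
  exact h2

variable {n : ℕ} {M : Type*} [TopologicalSpace M] [ChartedSpace (EuclideanQuadrant (n + 1)) M]

/-- The differential of the chart `e` at `x`. -/
def dChart (e : OpenPartialHomeomorph M (EuclideanQuadrant (n + 1))) (x : M) :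
    TangentSpace (QModel (n + 1)) x →L[ℝ] EuclideanSpace ℝ (Fin (n + 1)) :=
  mfderiv (QModel (n + 1)) 𝓘(ℝ, EuclideanSpace ℝ (Fin (n + 1))) (e.extend (QModel (n + 1))) x

/-- The tangent vector `v` of `M` at `x ∈ ∂¹M` points outward: in a chart that
maps `x` to the `i`-th face of the quadrant, its `i`-th coordinate is negative. -/
def IsOutward (x : stratum (n + 1) M 1)
    (v : TangentSpace (QModel (n + 1)) (incl n M x)) : Prop :=
  ∃ (e : OpenPartialHomeomorph M (EuclideanQuadrant (n + 1))) (i : Fin (n + 1)),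
    IsFaceChart e i (incl n M x) ∧ dChart e (incl n M x) v i < 0

variable [IsManifold (QModel (n + 1)) ∞ M]

theorem dChart_bijective {e : OpenPartialHomeomorph M (EuclideanQuadrant (n + 1))}
    (he : e ∈ atlas (EuclideanQuadrant (n + 1)) M) {x : M} (hx : x ∈ e.source) :
    Function.Bijective (dChart e x) := by
  have : IsManifold (QModel (n + 1)) 1 M := IsManifold.of_le (n := ∞) (by simp)
  have h1 := mdifferentiable_of_mem_atlas (I := QModel (n + 1)) he
  have h2 : HasMFDerivAt (QModel (n + 1)) 𝓘(ℝ, EuclideanSpace ℝ (Fin (n + 1)))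
      (e.extend (QModel (n + 1))) x _ :=
    ((QModel (n + 1)).hasMFDerivAt (x := e x)).comp x (h1.mdifferentiableAt hx).hasMFDerivAt
  have h3 : dChart e x = _ := h2.mfderiv
  rw [h3]
  exact h1.mfderiv_bijective hx

theorem exists_isOutward (x : stratum (n + 1) M 1) :
    ∃ v : TangentSpace (QModel (n + 1)) (incl n M x), IsOutward x v := by
  obtain ⟨e, i, h⟩ := exists_isFaceChart x.2
  obtain ⟨v, hv⟩ := (dChart_bijective h.mem_atlas h.mem_source).2 (-EuclideanSpace.single i 1)
  refine ⟨v, e, i, h, ?_⟩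
  have : dChart e (incl n M x) v = -EuclideanSpace.single i 1 := hv
  rw [this]
  simp

/-- The differential of the inclusion of `∂¹M` in `M`. -/
def dIncl (x : stratum (n + 1) M 1) :
    TangentSpace (𝓡 n) x →L[ℝ] TangentSpace (QModel (n + 1)) (incl n M x) :=
  mfderiv (𝓡 n) (QModel (n + 1)) (incl n M) x

theorem dChart_comp_dIncl {e : OpenPartialHomeomorph M (EuclideanQuadrant (n + 1))}
    {i : Fin (n + 1)} {x : stratum (n + 1) M 1} (h : IsFaceChart e i (incl n M x))
    (w : TangentSpace (𝓡 n) x) :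
    dChart e (incl n M x) (dIncl x w) =
      faceIncl i (mfderiv (𝓡 n) (𝓡 n) (faceChart e i x h.mem_atlas) x w) := by
  have h1 : MDifferentiableAt (𝓡 n) (QModel (n + 1)) (incl n M) x :=
    (contMDiff_incl x).mdifferentiableAt (by simp)
  have h2 : MDifferentiableAt (QModel (n + 1)) 𝓘(ℝ, EuclideanSpace ℝ (Fin (n + 1)))
      (e.extend (QModel (n + 1))) (incl n M x) :=
    (e.contMDiffAt_extend (n := ∞) (IsManifold.subset_maximalAtlas h.mem_atlas)
      h.mem_source).mdifferentiableAt (by simp)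
  set c := faceChart e i x h.mem_atlas with hc
  have hx : x ∈ c.source := h.mem_faceChart_source
  have h3 : MDifferentiableAt (𝓡 n) (𝓡 n) c x :=
    (contMDiffAt_of_mem_maximalAtlas (n := ∞)
      (IsManifold.subset_maximalAtlas (faceChart_mem_atlas e i x h.mem_atlas))
      hx).mdifferentiableAt (by simp)
  have h4 : HasMFDerivAt (𝓡 n) 𝓘(ℝ, EuclideanSpace ℝ (Fin (n + 1)))
      (faceIncl i ∘ c) x ((faceIncl i).comp (mfderiv (𝓡 n) (𝓡 n) c x)) :=
    ((faceIncl i).hasMFDerivAt (x := c x)).comp x h3.hasMFDerivAt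
  have h5 := h2.hasMFDerivAt.comp x h1.hasMFDerivAt
  have h6 : (e.extend (QModel (n + 1))) ∘ incl n M =ᶠ[𝓝 x] faceIncl i ∘ c := by
    filter_upwards [c.open_source.mem_nhds hx] with y hy
    exact (faceIncl_faceProj i _ (eq_zero_of_mem_stratum y.2 h.mem_atlas hy.1 hy.2)).symm
  have h7 := hasMFDerivAt_unique h5 (h4.congr_of_eventuallyEq h6)
  exact congrArg (fun T => T w) h7

theorem dIncl_injective (x : stratum (n + 1) M 1) : Function.Injective (dIncl x) := by
  obtain ⟨e, i, h⟩ := exists_isFaceChart x.2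
  have : IsManifold (𝓡 n) 1 (stratum (n + 1) M 1) := IsManifold.of_le (n := ∞) (by simp)
  have h1 := (mdifferentiable_of_mem_atlas (I := 𝓡 n)
    (faceChart_mem_atlas e i x h.mem_atlas)).mfderiv_injective h.mem_faceChart_source
  intro w w' hw
  have h2 := congrArg (dChart e (incl n M x)) hw
  rw [dChart_comp_dIncl h, dChart_comp_dIncl h] at h2
  apply h1
  exact (faceProj_faceIncl i _).symm.trans
    ((congrArg (faceProj i) h2).trans (faceProj_faceIncl i _))

theorem boundary_contraction_ne_zero (o : PointwiseOrientation (QModel (n + 1)) M)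
    (x : stratum (n + 1) M 1) {ν : TangentSpace (QModel (n + 1)) (incl n M x)}
    (hν : IsOutward x ν) :
    ((o (incl n M x)).someVector.curryLeft ν).compLinearMap (dIncl x).toLinearMap ≠ 0 := by
  obtain ⟨e, i, h, hneg⟩ := hν
  have hV : Module.finrank ℝ (TangentSpace (QModel (n + 1)) (incl n M x)) = n + 1 :=
    finrank_euclideanSpace_fin (𝕜 := ℝ) (n := n + 1)
  let b : Module.Basis (Fin n) ℝ (TangentSpace (𝓡 n) x) :=
    (EuclideanSpace.basisFun (Fin n) ℝ).toBasis
  let l : TangentSpace (QModel (n + 1)) (incl n M x) →ₗ[ℝ] ℝ :=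
    ((EuclideanSpace.proj i : EuclideanSpace ℝ (Fin (n + 1)) →L[ℝ] ℝ).comp
      (dChart e (incl n M x))).toLinearMap
  refine contraction_ne_zero hV b (Module.Ray.someVector_ne_zero _) _ (dIncl_injective x) l
    (fun w => ?_) (ν := ν) hneg.ne
  change dChart e (incl n M x) (dIncl x w) i = 0
  rw [dChart_comp_dIncl h]
  exact faceIncl_same i _

/-- The orientation of `∂¹M` as the boundary of `M` (outward normal first): if `ν` points outward
at `x`, then a frame `(w₁, …, wₙ)` of the tangent space of `∂¹M` is positive if and only
if the frame `(ν, w₁, …, wₙ)` of the tangent space of `M` is positive. -/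
def boundaryOrientation (o : PointwiseOrientation (QModel (n + 1)) M) :
    PointwiseOrientation (𝓡 n) (stratum (n + 1) M 1) := fun x =>
  rayOfNeZero ℝ
    (((o (incl n M x)).someVector.curryLeft (exists_isOutward x).choose).compLinearMap
      (dIncl x).toLinearMap)
    (boundary_contraction_ne_zero o x (exists_isOutward x).choose_spec)

end BoundaryOrientation

end CornerStokes
end

/-! Both sides are additive in the form, so a smooth partition of unity
(`exists_smooth_decomposition`) reduces the theorem to a form whose compact support lies in the
domain of one chart `e` (`stokes_of_support_subset_source`). There, multiplied by the locally
constant orientation sign of `e` and extended by zero, the form becomes a smooth compactly supported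
form on the whole quadrant (`contDiffOn_signedRep`). `stokes_quadrant` is then the divergence
theorem on a box `[0, R]^(n+1)` containing the support: the faces `x_i = R` contribute nothing, and
the face `x_i = 0` contributes with the sign `(-1)^(i+1)`.

On the boundary side, the faces of `e` give `n + 1` disjoint charts of `∂¹M`, and these cover the
part of `∂¹M` in the domain of `e`, because a corner of codimension one has exactly one vanishing
coordinate in every chart (`isFaceChart_of_mem_stratum`). The outward normal has negative `i`-th
coordinate, and moving it from the front to the `i`-th place of a frame costs `(-1)^i`. Hence the
boundary orientation produces the same sign `(-1)^(i+1)` (`frameSign_boundaryOrientation`), and the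
two sides agree face by face. Corners of higher codimension play no role: they are missing from the
open faces but have measure zero there. The restricted form is integrable although its support need
not be compact, since it is continuous up to the closed face and vanishes outside a bounded set.

The integral is defined by a sign and a measure that both depend on the form. To compute it,
`formMeasure_restrict_source` identifies the measure on the domain of a chart, and sign times
density is the signed coefficient there (`abs_mul_formSign_symm`). Additivity is proved in charts as
well, over a countable partition into Borel sets each contained in a chart domain. -/

noncomputable section

namespace CornerStokes

/-! ### Forms and the exterior derivative in charts. -/

section ChartForms

variable {E : Type*} [NormedAddCommGroup E] [NormedSpace ℝ E]
  {H : Type*} [TopologicalSpace H] {I : ModelWithCorners ℝ E H}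
  {M : Type*} [TopologicalSpace M] {e e' : OpenPartialHomeomorph M H} {y : E}

theorem mem_extendCoordChange_source :
    y ∈ (I.extendCoordChange e e').source ↔
      y ∈ (e.extend I).target ∧ (e.extend I).symm y ∈ e'.source := by
  simp [ModelWithCorners.extendCoordChange]

theorem extend_mem_extendCoordChange_source {x : M} (hx : x ∈ e.source) (hx' : x ∈ e'.source) :
    e.extend I x ∈ (I.extendCoordChange e e').source := by
  have hx1 : x ∈ (e.extend I).source := by rwa [e.extend_source]
  rw [mem_extendCoordChange_source]
  exact ⟨(e.extend I).map_source hx1, by rwa [(e.extend I).left_inv hx1]⟩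

theorem extend_target_mem_nhdsWithin_range (hy : y ∈ (e.extend I).target) :
    (e.extend I).target ∈ 𝓝[range I] y := by
  have h1 : (e.extend I).symm y ∈ (e.extend I).source := (e.extend I).map_target hy
  have h2 := e.extend_target_mem_nhdsWithin (I := I) (by rwa [e.extend_source] at h1)
  rwa [(e.extend I).right_inv hy] at h2

theorem extend_target_subset : (e.extend I).target ⊆ range I := by
  rw [e.extend_target]; exact inter_subset_right

theorem nhdsWithin_extend_target (hy : y ∈ (e.extend I).target) :
    𝓝[(e.extend I).target] y = 𝓝[range I] y :=
  le_antisymm (nhdsWithin_mono _ extend_target_subset)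
    (nhdsWithin_le_iff.2 (extend_target_mem_nhdsWithin_range hy))

theorem extendCoordChange_mapsTo : MapsTo (I.extendCoordChange e e') (range I) (range I) :=
  fun _ _ => mem_range_self _

theorem extendCoordChange_mem_target (hy : y ∈ (I.extendCoordChange e e').source) :
    I.extendCoordChange e e' y ∈ (e'.extend I).target :=
  ((I.extendCoordChange e e').map_source hy).1

theorem extend_symm_extendCoordChange (hy : y ∈ (I.extendCoordChange e e').source) :
    (e'.extend I).symm (I.extendCoordChange e e' y) = (e.extend I).symm y :=
  (e'.extend I).left_inv (by rw [e'.extend_source]; exact (mem_extendCoordChange_source.1 hy).2)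

variable [ChartedSpace H M]

theorem chartRep_add {k : ℕ} (e : OpenPartialHomeomorph M H) (α β : DiffForm I M k) (y : E) :
    chartRep I e (α + β) y = chartRep I e α y + chartRep I e β y := rfl

theorem chartRep_zero {k : ℕ} (e : OpenPartialHomeomorph M H) (y : E) :
    chartRep I e (0 : DiffForm I M k) y = 0 := rfl

theorem chartRep_sum {k : ℕ} {ι : Type*} (s : Finset ι) (e : OpenPartialHomeomorph M H)
    (α : ι → DiffForm I M k) (y : E) :
    chartRep I e (∑ j ∈ s, α j) y = ∑ j ∈ s, chartRep I e (α j) y := by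
  classical
  induction s using Finset.induction_on with
  | empty => simp [chartRep_zero]
  | insert a s ha ih => rw [Finset.sum_insert ha, Finset.sum_insert ha, chartRep_add, ih]

theorem chartRep_eq_zero {k : ℕ} {α : DiffForm I M k} (h : α ((e.extend I).symm y) = 0) :
    chartRep I e α y = 0 := by
  ext v
  exact congrArg (fun T => T (fun j => dChartSymm I e y (v j))) h

theorem SmoothForm.differentiableWithinAt {k : ℕ} {α : DiffForm I M k}
    (hα : SmoothForm I α) (he : e ∈ atlas H M) (hy : y ∈ (e.extend I).target) :
    DifferentiableWithinAt ℝ (chartRep I e α) (range I) y :=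
  ((hα e he y hy).differentiableWithinAt (by simp)).mono_of_mem_nhdsWithin
    (extend_target_mem_nhdsWithin_range hy)

theorem eq_zero_of_notMem_closure {k : ℕ} {α : DiffForm I M k} {x : M}
    (hx : x ∉ closure {x : M | α x ≠ 0}) : α x = 0 := by
  by_contra h
  exact hx (subset_closure h)

/-- The exterior derivative is local, and `α` vanishes on a whole neighbourhood of a point off its
support. -/
theorem extDer_eq_zero {k : ℕ} {α : DiffForm I M k} {x : M}
    (hx : x ∉ closure {x : M | α x ≠ 0}) : extDer I α x = 0 := by
  have hxr : extChartAt I x x ∈ range I := mem_range_self _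
  have h1 : chartRep I (chartAt H x) α =ᶠ[𝓝[range I] (extChartAt I x x)] fun _ => 0 := by
    have h2 : ContinuousWithinAt (extChartAt I x).symm (range I) (extChartAt I x x) :=
      (continuousAt_extChartAt_symm x).continuousWithinAt
    have h3 : (closure {x : M | α x ≠ 0})ᶜ ∈ 𝓝 ((extChartAt I x).symm (extChartAt I x x)) := by
      rw [extChartAt_to_inv]
      exact isClosed_closure.isOpen_compl.mem_nhds hx
    filter_upwards [h2 h3] with z hz
    exact chartRep_eq_zero (eq_zero_of_notMem_closure hz)
  have h4 : extDerivWithin (chartRep I (chartAt H x) α) (range I) (extChartAt I x x) = 0 := by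
    rw [h1.extDerivWithin_eq_of_mem hxr, extDerivWithin, fderivWithin_const_apply]
    exact map_zero (ContinuousAlternatingMap.alternatizeUncurryFinCLM ℝ E ℝ)
  ext v
  simp only [extDer, h4]
  rfl

theorem extDer_sum {k : ℕ} {ι : Type*} (s : Finset ι) {α : ι → DiffForm I M k}
    (hα : ∀ j ∈ s, SmoothForm I (α j)) :
    extDer I (∑ j ∈ s, α j) = ∑ j ∈ s, extDer I (α j) := by
  funext x
  have h1 : extDerivWithin (chartRep I (chartAt H x) (∑ j ∈ s, α j)) (range I)
      (extChartAt I x x) = ∑ j ∈ s, extDerivWithin (chartRep I (chartAt H x) (α j)) (range I)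
        (extChartAt I x x) := by
    have h2 : chartRep I (chartAt H x) (∑ j ∈ s, α j) =
        fun z => ∑ j ∈ s, chartRep I (chartAt H x) (α j) z :=
      funext fun z => chartRep_sum s _ α z
    have hx : extChartAt I x x ∈ range I := mem_range_self _
    rw [h2]
    simp only [extDerivWithin]
    rw [fderivWithin_fun_sum (I.uniqueDiffOn _ hx) fun j hj =>
      (hα j hj).differentiableWithinAt (chart_mem_atlas H x) (mem_extChartAt_target x)]
    exact map_sum (ContinuousAlternatingMap.alternatizeUncurryFinCLM ℝ E ℝ) _ s
  ext v
  rw [Finset.sum_apply, ContinuousAlternatingMap.sum_apply]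
  simp only [extDer, h1]
  exact ContinuousAlternatingMap.sum_apply _ _

variable [IsManifold I ∞ M]

theorem contDiffWithinAt_coordChange (he : e ∈ atlas H M) (he' : e' ∈ atlas H M)
    (hy : y ∈ (I.extendCoordChange e e').source) :
    ContDiffWithinAt ℝ ∞ (I.extendCoordChange e e') (range I) y :=
  I.contDiffWithinAt_extendCoordChange (IsManifold.subset_maximalAtlas he)
    (IsManifold.subset_maximalAtlas he') hy

theorem mdifferentiableWithinAt_extend_symm (he : e ∈ atlas H M) (hy : y ∈ (e.extend I).target) :
    MDifferentiableWithinAt 𝓘(ℝ, E) I (e.extend I).symm (range I) y := by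
  have h := contMDiffOn_extend_symm (I := I) (n := ∞) (IsManifold.subset_maximalAtlas he) y
    (by rwa [← e.extend_target' (I := I)])
  rw [← e.extend_target' (I := I)] at h
  exact (h.mdifferentiableWithinAt (by simp)).mono_of_mem_nhdsWithin
    (extend_target_mem_nhdsWithin_range hy)

theorem mdifferentiableAt_extend (he : e ∈ atlas H M) {x : M} (hx : x ∈ e.source) :
    MDifferentiableAt I 𝓘(ℝ, E) (e.extend I) x :=
  (e.contMDiffAt_extend (n := ∞) (IsManifold.subset_maximalAtlas he) hx).mdifferentiableAt
    (by simp)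

theorem dChartSymm_coordChange (he : e ∈ atlas H M) (he' : e' ∈ atlas H M)
    (hy : y ∈ (I.extendCoordChange e e').source) (v : E) :
    (dChartSymm I e y v : E) =
      dChartSymm I e' (I.extendCoordChange e e' y)
        (fderivWithin ℝ (I.extendCoordChange e e') (range I) y v) := by
  have hyt := (mem_extendCoordChange_source.1 hy).1
  have hyr : y ∈ range I := extend_target_subset hyt
  have h1 : MDifferentiableWithinAt 𝓘(ℝ, E) I (e'.extend I).symm (range I)
      (I.extendCoordChange e e' y) :=
    mdifferentiableWithinAt_extend_symm he' (extendCoordChange_mem_target hy)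
  have h2 : MDifferentiableWithinAt 𝓘(ℝ, E) 𝓘(ℝ, E) (I.extendCoordChange e e') (range I) y :=
    ((contDiffWithinAt_coordChange he he' hy).differentiableWithinAt
      (by simp)).mdifferentiableWithinAt
  have hu : UniqueMDiffWithinAt 𝓘(ℝ, E) (range I) y := (I.uniqueDiffOn y hyr).uniqueMDiffWithinAt
  have h3 := h1.hasMFDerivWithinAt.comp y h2.hasMFDerivWithinAt extendCoordChange_mapsTo
  have h4 : (e.extend I).symm =ᶠ[𝓝[range I] y]
      (e'.extend I).symm ∘ (I.extendCoordChange e e') := by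
    filter_upwards [I.extendCoordChange_source_mem_nhdsWithin hy] with z hz
    exact (extend_symm_extendCoordChange hz).symm
  have h5 := (h3.congr_of_eventuallyEq h4 (h4.self_of_nhdsWithin hyr)).mfderivWithin hu
  have h6 := congrArg (fun T : E →L[ℝ] E => T v) h5
  rw [mfderivWithin_eq_fderivWithin] at h6
  exact h6

theorem mfderiv_extend_comp_dChartSymm (he : e ∈ atlas H M) (he' : e' ∈ atlas H M)
    (hy : y ∈ (I.extendCoordChange e e').source) :
    (mfderiv I 𝓘(ℝ, E) (e'.extend I) ((e.extend I).symm y)).comp (dChartSymm I e y) =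
      fderivWithin ℝ (I.extendCoordChange e e') (range I) y := by
  have hyt := mem_extendCoordChange_source.1 hy
  have hu : UniqueMDiffWithinAt 𝓘(ℝ, E) (range I) y :=
    (I.uniqueDiffOn y (extend_target_subset hyt.1)).uniqueMDiffWithinAt
  rw [← mfderivWithin_eq_fderivWithin]
  exact (mfderiv_comp_mfderivWithin y (mdifferentiableAt_extend he' hyt.2)
    (mdifferentiableWithinAt_extend_symm he hyt.1) hu).symm

theorem mfderiv_extend_comp_dChartSymm_self (he : e ∈ atlas H M) (hy : y ∈ (e.extend I).target)
    (v : E) :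
    mfderiv I 𝓘(ℝ, E) (e.extend I) ((e.extend I).symm y) (dChartSymm I e y v) = v := by
  have hs : (e.extend I).symm y ∈ e.source := by
    have := (e.extend I).map_target hy
    rwa [e.extend_source] at this
  have h1 := mfderiv_extend_comp_dChartSymm (I := I) he he (y := y)
    (mem_extendCoordChange_source.2 ⟨hy, hs⟩)
  have hyr := extend_target_subset hy
  have h2 : fderivWithin ℝ (I.extendCoordChange e e) (range I) y = ContinuousLinearMap.id ℝ E := by
    have h3 : I.extendCoordChange e e =ᶠ[𝓝[range I] y] id := by
      filter_upwards [extend_target_mem_nhdsWithin_range hy] with z hz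
      exact (e.extend I).right_inv hz
    rw [h3.fderivWithin_eq (h3.self_of_nhdsWithin hyr),
      fderivWithin_id (I.uniqueDiffOn y hyr)]
  rw [h2] at h1
  exact congrArg (fun T : E →L[ℝ] E => T v) h1

theorem chartRep_coordChange {k : ℕ} (he : e ∈ atlas H M) (he' : e' ∈ atlas H M)
    (hy : y ∈ (I.extendCoordChange e e').source) (α : DiffForm I M k) :
    chartRep I e α y = (chartRep I e' α (I.extendCoordChange e e' y)).compContinuousLinearMap
      (fderivWithin ℝ (I.extendCoordChange e e') (range I) y) := by
  ext v
  -- All tangent spaces are `E` by definition; fixing the codomain avoids transport along the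
  -- equality of base points.
  have h1 := congrArg (β := E [⋀^Fin k]→L[ℝ] ℝ) (fun x => α x) (extend_symm_extendCoordChange hy)
  have h2 : (fun j => (dChartSymm I e y (v j) : E)) = fun j =>
      dChartSymm I e' (I.extendCoordChange e e' y)
        (fderivWithin ℝ (I.extendCoordChange e e') (range I) y (v j)) :=
    funext fun j => dChartSymm_coordChange he he' hy (v j)
  exact (congrArg (fun w => (α ((e.extend I).symm y) : E [⋀^Fin k]→L[ℝ] ℝ) w) h2).trans
    (congrArg (fun T : E [⋀^Fin k]→L[ℝ] ℝ => T _) h1.symm)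

/-- The exterior derivative can be computed in every chart of the atlas. -/
theorem chartRep_extDer {k : ℕ} {α : DiffForm I M k} (hα : SmoothForm I α) (he : e ∈ atlas H M)
    (hy : y ∈ (e.extend I).target) :
    chartRep I e (extDer I α) y = extDerivWithin (chartRep I e α) (range I) y := by
  have hs : (e.extend I).symm y ∈ e.source := by
    have := (e.extend I).map_target hy
    rwa [e.extend_source] at this
  have hyr := extend_target_subset hy
  set x := (e.extend I).symm y with hx
  set c := chartAt H x with hc
  have hca : c ∈ atlas H M := chart_mem_atlas H x
  have hys : y ∈ (I.extendCoordChange e c).source :=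
    mem_extendCoordChange_source.2 ⟨hy, mem_chart_source H x⟩
  have h1 : chartRep I e α =ᶠ[𝓝[range I] y] fun z =>
      (chartRep I c α (I.extendCoordChange e c z)).compContinuousLinearMap
        (fderivWithin ℝ (I.extendCoordChange e c) (range I) z) := by
    filter_upwards [I.extendCoordChange_source_mem_nhdsWithin hys] with z hz
    exact chartRep_coordChange he hca hz α
  have hd : DifferentiableWithinAt ℝ (chartRep I c α) (range I) (I.extendCoordChange e c y) :=
    ((hα c hca _ (extendCoordChange_mem_target hys)).differentiableWithinAt
      (by simp)).mono_of_mem_nhdsWithin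
        (extend_target_mem_nhdsWithin_range (extendCoordChange_mem_target hys))
  -- Here `d` commutes with the pullback along the change of charts. This rests on the symmetry of
  -- second derivatives, hence the `C^2` bound and the closure of the interior.
  rw [h1.extDerivWithin_eq_of_mem hyr,
    extDerivWithin_pullback (r := ∞) hd (contDiffWithinAt_coordChange he hca hys)
      (by simpa using (WithTop.coe_le_coe.2 le_top : ((2 : ℕ∞) : WithTop ℕ∞) ≤ ∞)) I.uniqueDiffOn
      (I.range_subset_closure_interior hyr) hyr extendCoordChange_mapsTo,
    ← mfderiv_extend_comp_dChartSymm he hca hys]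
  rfl

theorem SmoothForm.continuousOn_chartRep_extDer {k : ℕ} {α : DiffForm I M k}
    (hα : SmoothForm I α) (he : e ∈ atlas H M) :
    ContinuousOn (chartRep I e (extDer I α)) (e.extend I).target := by
  have h1 : ContinuousOn (extDerivWithin (chartRep I e α) (e.extend I).target)
      (e.extend I).target := by
    have hu : UniqueDiffOn ℝ (e.extend I).target := by
      rw [e.extend_target]
      exact I.uniqueDiffOn_preimage e.open_target
    exact (ContinuousAlternatingMap.alternatizeUncurryFinCLM ℝ E ℝ).continuous.comp_continuousOn
      ((hα e he).continuousOn_fderivWithin hu (by simp))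
  refine h1.congr fun y hy => ?_
  -- The target of the chart is relatively open in `range I`, so derivatives within the two sets
  -- coincide.
  rw [chartRep_extDer hα he hy, extDerivWithin, extDerivWithin,
    fderivWithin_of_mem_nhdsWithin (extend_target_mem_nhdsWithin_range hy)
      (I.uniqueDiffOn y (extend_target_subset hy))
      ((hα e he y hy).differentiableWithinAt (by simp))]

theorem SmoothForm.smul {k : ℕ} {α : DiffForm I M k} (hα : SmoothForm I α) {ρ : M → ℝ}
    (hρ : ContMDiff I 𝓘(ℝ, ℝ) ∞ ρ) : SmoothForm I (M := M) (fun x => ρ x • α x) := by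
  intro e he
  have h1 : ContDiffOn ℝ ∞ (ρ ∘ (e.extend I).symm) (e.extend I).target := by
    have h := contMDiffOn_extend_symm (I := I) (n := ∞) (IsManifold.subset_maximalAtlas he)
    rw [← e.extend_target' (I := I)] at h
    exact (hρ.comp_contMDiffOn h).contDiffOn
  exact h1.smul (hα e he)

end ChartForms

theorem measurableSet_inter_preimage {X Y : Type*} [TopologicalSpace X] [MeasurableSpace X]
    [OpensMeasurableSpace X] [TopologicalSpace Y] [MeasurableSpace Y] [BorelSpace Y]
    {f : X → Y} {s : Set X} (hf : ContinuousOn f s) (hs : MeasurableSet s) {B : Set Y}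
    (hB : MeasurableSet B) : MeasurableSet (s ∩ f ⁻¹' B) := by
  have h := hs.subtype_image ((continuousOn_iff_continuous_domRestrict.1 hf).measurable hB)
  convert h using 1
  ext x
  simp [and_comm]

/-! ### Linear algebra of forms of top degree. -/

section TopDegree

variable {k : ℕ}

theorem coe_basisFun_eq_stdFrame :
    ⇑(EuclideanSpace.basisFun (Fin k) ℝ).toBasis = stdFrame k := by
  ext i j
  simp [stdFrame]

/-- A form of top degree is multiplied by the determinant under a linear map. -/
theorem topForm_comp_apply (ξ : EuclideanSpace ℝ (Fin k) [⋀^Fin k]→L[ℝ] ℝ)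
    (L : EuclideanSpace ℝ (Fin k) →L[ℝ] EuclideanSpace ℝ (Fin k)) :
    ξ (fun i => L (stdFrame k i)) = L.det * ξ (stdFrame k) := by
  have h := ξ.toAlternatingMap.eq_smul_basis_det (EuclideanSpace.basisFun (Fin k) ℝ).toBasis
  have h1 : ∀ v, ξ v = ξ (stdFrame k) * (EuclideanSpace.basisFun (Fin k) ℝ).toBasis.det v := by
    intro v
    have := congrArg (fun T => T v) h
    rw [coe_basisFun_eq_stdFrame] at this
    exact this
  have h2 := (EuclideanSpace.basisFun (Fin k) ℝ).toBasis.det_comp L.toLinearMap (stdFrame k)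
  rw [h1, mul_comm]
  congr 1
  refine h2.trans ?_
  rw [← coe_basisFun_eq_stdFrame, Module.Basis.det_self, mul_one]

theorem topForm_eq_smul {V : Type*} [AddCommGroup V] [Module ℝ V] (b : Module.Basis (Fin k) ℝ V)
    {φ : V [⋀^Fin k]→ₗ[ℝ] ℝ} (hφ : φ ≠ 0) (η : V [⋀^Fin k]→ₗ[ℝ] ℝ) :
    ∃ c : ℝ, η = c • φ := by
  have hb : φ b ≠ 0 := (φ.map_basis_ne_zero_iff b).2 hφ
  refine ⟨η b / φ b, ?_⟩
  ext v
  have h1 := congrArg (fun T => T v) (η.eq_smul_basis_det b)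
  have h2 := congrArg (fun T => T v) (φ.eq_smul_basis_det b)
  simp only [AlternatingMap.smul_apply, smul_eq_mul] at h1 h2 ⊢
  rw [h1, h2]
  field_simp

theorem topForm_ne_zero {V : Type*} [AddCommGroup V] [Module ℝ V] (b : Module.Basis (Fin k) ℝ V)
    {φ : V [⋀^Fin k]→ₗ[ℝ] ℝ} (hφ : φ ≠ 0) {v : Fin k → V} (hv : LinearIndependent ℝ v) :
    φ v ≠ 0 := by
  have : FiniteDimensional ℝ V := Module.Finite.of_basis b
  have hV : Fintype.card (Fin k) = Module.finrank ℝ V := (Module.finrank_eq_card_basis b).symm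
  have h := (φ.map_basis_ne_zero_iff (basisOfLinearIndependentOfCardEqFinrank' v hv hV)).2 hφ
  rwa [coe_basisOfLinearIndependentOfCardEqFinrank'] at h

end TopDegree

/-! ### Sign and density of a form of top degree in a chart. -/

section Integration

variable {k : ℕ} {H : Type*} [TopologicalSpace H]
  {I : ModelWithCorners ℝ (EuclideanSpace ℝ (Fin k)) H}
  {N : Type*} [TopologicalSpace N] {e e' : OpenPartialHomeomorph N H}

theorem measurableSet_extend_target : MeasurableSet (e.extend I).target := by
  rw [e.extend_target]
  exact (e.open_target.preimage I.continuous_symm).measurableSet.inter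
    I.isClosed_range.measurableSet

variable [ChartedSpace H N]

/-- Forms of top degree at a point are multiples `c • φ` of the orientation form `φ`. On any frame
with `φ v ≠ 0`, the sign of `φ v` occurs twice and cancels, leaving the sign of `c`. -/
theorem formSign_eq_frameSign_mul (o : PointwiseOrientation I N) (η : DiffForm I N k) (x : N)
    {v : Fin k → TangentSpace I x} (hv : (o x).someVector v ≠ 0) :
    formSign I o η x = (frameSign (o x) v : ℝ) * (SignType.sign (η x v) : ℝ) := by
  let b : Module.Basis (Fin k) ℝ (TangentSpace I x) :=
    (EuclideanSpace.basisFun (Fin k) ℝ).toBasis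
  obtain ⟨c, hc⟩ := topForm_eq_smul b (o x).someVector_ne_zero (η x).toAlternatingMap
  have hηv : η x v = c * (o x).someVector v := congrArg (fun T => T v) hc
  have hz : η x = 0 ↔ c = 0 := by
    constructor
    · intro h
      rw [h] at hηv
      have : c * (o x).someVector v = 0 := hηv.symm
      exact (mul_eq_zero.1 this).resolve_right hv
    · rintro rfl
      ext w
      have := congrArg (fun T => T w) hc
      simpa using this
  have hsign : (frameSign (o x) v : ℝ) * (SignType.sign (η x v) : ℝ) = SignType.sign c := by
    rw [hηv, frameSign, sign_mul]
    rcases lt_or_gt_of_ne hv with h | h <;> simp [h]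
  rw [hsign, formSign]
  rcases lt_trichotomy c 0 with h | h | h
  · have h1 : ¬ SameRay ℝ (o x).someVector (η x).toAlternatingMap := by
      rw [hc]
      intro h2
      obtain ⟨r₁, r₂, hr₁, hr₂, hr⟩ := h2.exists_pos (o x).someVector_ne_zero
        (smul_ne_zero h.ne (o x).someVector_ne_zero)
      have h3 : r₁ * (o x).someVector v = r₂ * (c * (o x).someVector v) :=
        congrArg (fun T => T v) hr
      rw [← mul_assoc] at h3
      have h4 := mul_right_cancel₀ hv h3
      nlinarith [mul_neg_of_pos_of_neg hr₂ h]
    rw [if_neg (fun h2 => h.ne (hz.1 h2)), if_neg h1]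
    simp [h]
  · rw [if_pos (hz.2 h)]
    simp [h]
  · have h1 : SameRay ℝ (o x).someVector (η x).toAlternatingMap := by
      rw [hc]
      exact (SameRay.refl _).pos_smul_right h
    rw [if_neg (fun h2 => h.ne' (hz.1 h2)), if_pos h1]
    simp [h]

/-- The sign of the coordinate frame of the chart `e`. -/
def chartSign (o : PointwiseOrientation I N) (e : OpenPartialHomeomorph N H)
    (y : EuclideanSpace ℝ (Fin k)) : ℝ :=
  (frameSign (o ((e.extend I).symm y)) (fun i => dChartSymm I e y (stdFrame k i)) : ℝ)

/-- The density of the form `η` relative to the orientation `o`, in the chart `e`. -/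
def chartDensity (o : PointwiseOrientation I N) (η : DiffForm I N k)
    (e : OpenPartialHomeomorph N H) (y : EuclideanSpace ℝ (Fin k)) : ℝ :=
  chartSign o e y * chartRep I e η y (stdFrame k)

/-- A form is continuous if it is continuous in every chart of the atlas. -/
def ContinuousForm {j : ℕ} (η : DiffForm I N j) : Prop :=
  ∀ e ∈ atlas H N, ContinuousOn (chartRep I e η) (e.extend I).target

theorem IsOrientation.continuousOn_chartSign {o : PointwiseOrientation I N}
    (ho : IsOrientation I o) (he : e ∈ atlas H N) :
    ContinuousOn (chartSign o e) (e.extend I).target := by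
  intro y hy
  refine tendsto_const_nhds.congr' ?_
  filter_upwards [ho e he y hy] with z hz
  simp only [chartSign, hz]

theorem ContinuousForm.continuousOn_apply {j : ℕ} {η : DiffForm I N j} (hη : ContinuousForm η)
    (he : e ∈ atlas H N) (v : Fin j → EuclideanSpace ℝ (Fin k)) :
    ContinuousOn (fun y => chartRep I e η y v) (e.extend I).target :=
  (ContinuousAlternatingMap.apply ℝ _ ℝ v).continuous.comp_continuousOn (hη e he)

variable {o : PointwiseOrientation I N}

theorem chartDensity_sum {ι : Type*} (s : Finset ι) (η : ι → DiffForm I N k)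
    (y : EuclideanSpace ℝ (Fin k)) :
    chartDensity o (∑ j ∈ s, η j) e y = ∑ j ∈ s, chartDensity o (η j) e y := by
  simp only [chartDensity, chartRep_sum, ContinuousAlternatingMap.sum_apply, Finset.mul_sum]

theorem ContinuousForm.sum {ι : Type*} {s : Finset ι} {η : ι → DiffForm I N k}
    (hη : ∀ j ∈ s, ContinuousForm (η j)) : ContinuousForm (∑ j ∈ s, η j) := by
  intro e he
  have : chartRep I e (∑ j ∈ s, η j) = fun y => ∑ j ∈ s, chartRep I e (η j) y :=
    funext fun y => chartRep_sum s e η y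
  rw [this]
  exact continuousOn_finsetSum s fun j hj => hη j hj e he

theorem ContinuousForm.continuousOn_chartDensity (ho : IsOrientation I o) {η : DiffForm I N k}
    (hη : ContinuousForm η) (he : e ∈ atlas H N) :
    ContinuousOn (chartDensity o η e) (e.extend I).target :=
  (ho.continuousOn_chartSign he).mul (hη.continuousOn_apply he _)

theorem formSign_eq_zero {η : DiffForm I N k} {x : N} (h : η x = 0) : formSign I o η x = 0 :=
  if_pos h

variable [IsManifold I ∞ N]

theorem someVector_chartFrame_ne_zero (o : PointwiseOrientation I N) (he : e ∈ atlas H N)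
    {y : EuclideanSpace ℝ (Fin k)} (hy : y ∈ (e.extend I).target) :
    (o ((e.extend I).symm y)).someVector (fun i => dChartSymm I e y (stdFrame k i)) ≠ 0 := by
  have hinj : Function.Injective (dChartSymm I e y) :=
    Function.LeftInverse.injective (mfderiv_extend_comp_dChartSymm_self (I := I) he hy)
  have hli : LinearIndependent ℝ (fun i => dChartSymm I e y (stdFrame k i)) := by
    have h := (EuclideanSpace.basisFun (Fin k) ℝ).toBasis.linearIndependent
    rw [coe_basisFun_eq_stdFrame] at h
    exact h.map' (dChartSymm I e y).toLinearMap (LinearMap.ker_eq_bot.2 hinj)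
  let b : Module.Basis (Fin k) ℝ (TangentSpace I ((e.extend I).symm y)) :=
    (EuclideanSpace.basisFun (Fin k) ℝ).toBasis
  exact topForm_ne_zero b (o _).someVector_ne_zero hli

theorem formSign_symm (o : PointwiseOrientation I N) (η : DiffForm I N k) (he : e ∈ atlas H N)
    {y : EuclideanSpace ℝ (Fin k)} (hy : y ∈ (e.extend I).target) :
    formSign I o η ((e.extend I).symm y) =
      chartSign o e y * (SignType.sign (chartRep I e η y (stdFrame k)) : ℝ) :=
  formSign_eq_frameSign_mul o η _ (someVector_chartFrame_ne_zero o he hy)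

/-- The density of the measure times the sign of the form is the signed coefficient, which is linear
in the form. This turns integrals of `formSign` into integrals of `chartDensity`. -/
theorem abs_mul_formSign_symm (o : PointwiseOrientation I N) (η : DiffForm I N k)
    (he : e ∈ atlas H N) {y : EuclideanSpace ℝ (Fin k)} (hy : y ∈ (e.extend I).target) :
    |chartRep I e η y (stdFrame k)| * formSign I o η ((e.extend I).symm y) =
      chartDensity o η e y := by
  rw [formSign_symm o η he hy, chartDensity, mul_left_comm, mul_comm (|_|), sign_mul_abs]

end Integration

/-! ### The measure of a form of top degree, and integration over charts. -/

section FormMeasure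

variable {k : ℕ} {H : Type*} [TopologicalSpace H]
  {I : ModelWithCorners ℝ (EuclideanSpace ℝ (Fin k)) H}
  {N : Type*} [TopologicalSpace N] [MeasurableSpace N] [BorelSpace N]
  {e e' : OpenPartialHomeomorph N H}

theorem measurableSet_target_inter_preimage {B : Set N} (hB : MeasurableSet B) :
    MeasurableSet ((e.extend I).target ∩ (e.extend I).symm ⁻¹' B) :=
  measurableSet_inter_preimage e.continuousOn_extend_symm measurableSet_extend_target hB

theorem aemeasurable_extend_symm {S : Set (EuclideanSpace ℝ (Fin k))} (hS : MeasurableSet S)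
    (hST : S ⊆ (e.extend I).target) (d : EuclideanSpace ℝ (Fin k) → ENNReal) :
    AEMeasurable (e.extend I).symm ((volume.restrict S).withDensity d) :=
  ((e.continuousOn_extend_symm.mono hST).aemeasurable hS).mono_ac
    (withDensity_absolutelyContinuous _ _)

theorem map_extend_symm_apply {S : Set (EuclideanSpace ℝ (Fin k))} (hS : MeasurableSet S)
    (hST : S ⊆ (e.extend I).target) (d : EuclideanSpace ℝ (Fin k) → ENNReal) {B : Set N}
    (hB : MeasurableSet B) :
    Measure.map (e.extend I).symm ((volume.restrict S).withDensity d) B =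
      ∫⁻ y in S ∩ (e.extend I).symm ⁻¹' B, d y := by
  rw [Measure.map_apply_of_aemeasurable (aemeasurable_extend_symm hS hST d) hB,
    withDensity_apply', Measure.restrict_restrict' hS, inter_comm]

variable [ChartedSpace H N]

theorem chartMeasure_apply (η : DiffForm I N k) (e : OpenPartialHomeomorph N H) {B : Set N}
    (hB : MeasurableSet B) :
    chartMeasure I η e B = ∫⁻ y in (e.extend I).target ∩ (e.extend I).symm ⁻¹' B,
      ENNReal.ofReal |chartRep I e η y (stdFrame k)| :=
  map_extend_symm_apply measurableSet_extend_target subset_rfl _ hB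

theorem chartMeasure_restrict (η : DiffForm I N k) (e : OpenPartialHomeomorph N H) {B : Set N}
    (hB : MeasurableSet B) :
    (chartMeasure I η e).restrict B = Measure.map (e.extend I).symm
      ((volume.restrict ((e.extend I).target ∩ (e.extend I).symm ⁻¹' B)).withDensity
        fun y => ENNReal.ofReal |chartRep I e η y (stdFrame k)|) := by
  ext A hA
  rw [Measure.restrict_apply hA, chartMeasure_apply η e (hA.inter hB),
    map_extend_symm_apply (measurableSet_target_inter_preimage hB) inter_subset_left _ hA,
    inter_assoc, preimage_inter, inter_comm ((e.extend I).symm ⁻¹' A)]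

theorem chartMeasure_restrict_source (η : DiffForm I N k) (e : OpenPartialHomeomorph N H) :
    (chartMeasure I η e).restrict e.source = chartMeasure I η e := by
  rw [chartMeasure_restrict η e e.open_source.measurableSet, chartMeasure,
    inter_eq_left.2 fun y hy => ?_]
  have := (e.extend I).map_target hy
  rwa [e.extend_source] at this

theorem aemeasurable_density {η : DiffForm I N k} (hη : ContinuousForm η) (he : e ∈ atlas H N)
    {B : Set N} (hB : MeasurableSet B) :
    AEMeasurable (fun y => ENNReal.ofReal |chartRep I e η y (stdFrame k)|)
      (volume.restrict ((e.extend I).target ∩ (e.extend I).symm ⁻¹' B)) :=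
  (((hη.continuousOn_apply he _).mono inter_subset_left).abs.aemeasurable
    (measurableSet_target_inter_preimage hB)).ennreal_ofReal

variable [IsManifold I ∞ N]

/-- Change of variables: the coefficient of a form of top degree is multiplied by the determinant of
the differential of the change of charts, whose absolute value is the Jacobian factor. -/
theorem chartMeasure_eq_of_subset (η : DiffForm I N k) (he : e ∈ atlas H N) (he' : e' ∈ atlas H N)
    {B : Set N} (hB : MeasurableSet B) (hBe : B ⊆ e.source) (hBe' : B ⊆ e'.source) :
    chartMeasure I η e B = chartMeasure I η e' B := by
  rw [chartMeasure_apply η e hB, chartMeasure_apply η e' hB]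
  set S := (e.extend I).target ∩ (e.extend I).symm ⁻¹' B with hS
  have hmem : ∀ y ∈ S, y ∈ (I.extendCoordChange e e').source := fun y hy =>
    mem_extendCoordChange_source.2 ⟨hy.1, hBe' hy.2⟩
  have himage : I.extendCoordChange e e' '' S =
      (e'.extend I).target ∩ (e'.extend I).symm ⁻¹' B := by
    apply Subset.antisymm
    · rintro _ ⟨y, hy, rfl⟩
      refine ⟨extendCoordChange_mem_target (hmem y hy), ?_⟩
      rw [mem_preimage, extend_symm_extendCoordChange (hmem y hy)]
      exact hy.2
    · rintro z ⟨hz, hzB⟩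
      have hz' : z ∈ (I.extendCoordChange e' e).source :=
        mem_extendCoordChange_source.2 ⟨hz, hBe hzB⟩
      refine ⟨I.extendCoordChange e' e z, ⟨extendCoordChange_mem_target hz', ?_⟩,
        (I.extendCoordChange e' e).left_inv hz'⟩
      rw [mem_preimage, extend_symm_extendCoordChange hz']
      exact hzB
  rw [← himage, lintegral_image_eq_lintegral_abs_det_fderiv_mul volume
    (measurableSet_target_inter_preimage hB)
    (f' := fderivWithin ℝ (I.extendCoordChange e e') (range I))
    (fun y hy => ((contDiffWithinAt_coordChange he he' (hmem y hy)).differentiableWithinAt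
      (by simp)).hasFDerivWithinAt.mono fun z hz => extend_target_subset hz.1)
    ((I.extendCoordChange e e').injOn.mono hmem)]
  refine setLIntegral_congr_fun (measurableSet_target_inter_preimage hB) fun y hy => ?_
  rw [← ENNReal.ofReal_mul (abs_nonneg _), ← abs_mul, ← topForm_comp_apply,
    chartRep_coordChange he he' (hmem y hy)]
  rfl

/-- The measure of a form of top degree is, on the domain of each chart, the one given by its
coordinate expression. -/
theorem formMeasure_restrict_source (η : DiffForm I N k) (he : e ∈ atlas H N) :
    (formMeasure I η).restrict e.source = chartMeasure I η e := by
  have hm := e.open_source.measurableSet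
  apply le_antisymm
  · have hle : formMeasure I η ≤
        chartMeasure I η e + (⊤ : Measure N).restrict e.sourceᶜ := by
      refine iSup₂_le fun e' he' => ?_
      rw [← Measure.restrict_add_restrict_compl (μ := chartMeasure I η e') hm]
      refine add_le_add ?_ (Measure.restrict_mono subset_rfl le_top)
      rw [Measure.le_iff]
      intro B hB
      rw [Measure.restrict_apply hB, ← chartMeasure_restrict_source η e']
      rw [Measure.restrict_apply (hB.inter hm),
        chartMeasure_eq_of_subset η he' he ((hB.inter hm).inter e'.open_source.measurableSet)
          inter_subset_right (inter_subset_left.trans inter_subset_right)]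
      exact measure_mono (inter_subset_left.trans inter_subset_left)
    refine (Measure.restrict_mono subset_rfl hle).trans ?_
    rw [Measure.restrict_add, Measure.restrict_restrict hm, inter_compl_self,
      Measure.restrict_empty, add_zero, chartMeasure_restrict_source]
  · rw [← chartMeasure_restrict_source]
    exact Measure.restrict_mono subset_rfl (le_iSup₂_of_le e he le_rfl)

theorem formMeasure_restrict (η : DiffForm I N k) (he : e ∈ atlas H N) {B : Set N}
    (hB : MeasurableSet B) (hBe : B ⊆ e.source) :
    (formMeasure I η).restrict B = Measure.map (e.extend I).symm
      ((volume.restrict ((e.extend I).target ∩ (e.extend I).symm ⁻¹' B)).withDensity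
        fun y => ENNReal.ofReal |chartRep I e η y (stdFrame k)|) := by
  rw [← chartMeasure_restrict η e hB, ← formMeasure_restrict_source η he,
    Measure.restrict_restrict hB, inter_eq_left.2 hBe]

theorem measurable_sign_real : Measurable (fun t : ℝ => (SignType.sign t : ℝ)) := by
  have : (fun t : ℝ => (SignType.sign t : ℝ)) =
      fun t => if 0 < t then 1 else if t < 0 then -1 else 0 := by
    ext t
    rcases lt_trichotomy t 0 with h | h | h
    · simp [h, h.not_gt]
    · simp [h]
    · simp [h]
  rw [this]
  exact Measurable.ite measurableSet_Ioi measurable_const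
    (Measurable.ite measurableSet_Iio measurable_const measurable_const)

/-- Countably many chart domains cover the manifold, and on each of them the sign of the form is a
Borel function of two quantities continuous in the chart: the chart sign and the coefficient. -/
theorem measurable_formSign [SecondCountableTopology N] {o : PointwiseOrientation I N}
    (ho : IsOrientation I o) {η : DiffForm I N k} (hη : ContinuousForm η) :
    Measurable (formSign I o η) := by
  obtain ⟨s, hs, hsu⟩ := TopologicalSpace.countable_cover_nhds
    (fun x : N => (chartAt H x).open_source.mem_nhds (mem_chart_source H x))
  intro B hB
  have h1 : formSign I o η ⁻¹' B = ⋃ x ∈ s, (chartAt H x).source ∩ formSign I o η ⁻¹' B := by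
    rw [← iUnion₂_inter, hsu, univ_inter]
  rw [h1]
  refine MeasurableSet.biUnion hs fun x _ => ?_
  have he := chart_mem_atlas H x
  set e := chartAt H x
  have h2 : e.source ∩ formSign I o η ⁻¹' B = e.source ∩ e.extend I ⁻¹' ((e.extend I).target ∩
      (fun y => (chartSign o e y, chartRep I e η y (stdFrame k))) ⁻¹'
        ((fun p : ℝ × ℝ => p.1 * (SignType.sign p.2 : ℝ)) ⁻¹' B)) := by
    ext z
    simp only [mem_inter_iff, mem_preimage]
    refine and_congr_right fun hz => ?_
    have hz' : z ∈ (e.extend I).source := by rwa [e.extend_source]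
    have h3 := formSign_symm o η he ((e.extend I).map_source hz')
    rw [(e.extend I).left_inv hz'] at h3
    rw [h3]
    exact ⟨fun h => ⟨(e.extend I).map_source hz', h⟩, fun h => h.2⟩
  rw [h2]
  refine measurableSet_inter_preimage (e.continuousOn_extend.mono (by rw [e.extend_source]))
    e.open_source.measurableSet ?_
  refine measurableSet_inter_preimage ((ho.continuousOn_chartSign he).prodMk
    (hη.continuousOn_apply he _)) measurableSet_extend_target ?_
  exact (measurable_fst.mul (measurable_sign_real.comp measurable_snd)) hB

variable [SecondCountableTopology N] {o : PointwiseOrientation I N}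

theorem integrableOn_formSign_iff (ho : IsOrientation I o) {η : DiffForm I N k}
    (hη : ContinuousForm η) (he : e ∈ atlas H N) {B : Set N} (hB : MeasurableSet B)
    (hBe : B ⊆ e.source) :
    IntegrableOn (formSign I o η) B (formMeasure I η) ↔
      IntegrableOn (chartDensity o η e) ((e.extend I).target ∩ (e.extend I).symm ⁻¹' B) := by
  have hS := measurableSet_target_inter_preimage (I := I) (e := e) hB
  rw [IntegrableOn, formMeasure_restrict η he hB hBe,
    integrable_map_measure (measurable_formSign ho hη).aestronglyMeasurable
      (aemeasurable_extend_symm hS inter_subset_left _),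
    integrable_withDensity_iff_integrable_smul₀' (aemeasurable_density hη he hB) (by simp)]
  refine integrableOn_congr_fun (fun y hy => ?_) hS
  rw [← abs_mul_formSign_symm o η he hy.1, ENNReal.toReal_ofReal (abs_nonneg _)]
  rfl

theorem setIntegral_formSign (ho : IsOrientation I o) {η : DiffForm I N k}
    (hη : ContinuousForm η) (he : e ∈ atlas H N) {B : Set N} (hB : MeasurableSet B)
    (hBe : B ⊆ e.source) :
    ∫ x in B, formSign I o η x ∂(formMeasure I η) =
      ∫ y in (e.extend I).target ∩ (e.extend I).symm ⁻¹' B, chartDensity o η e y := by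
  have hS := measurableSet_target_inter_preimage (I := I) (e := e) hB
  rw [formMeasure_restrict η he hB hBe,
    integral_map (aemeasurable_extend_symm hS inter_subset_left _)
      (measurable_formSign ho hη).aestronglyMeasurable,
    integral_withDensity_eq_integral_toReal_smul₀ (aemeasurable_density hη he hB) (by simp)]
  refine setIntegral_congr_fun hS (fun y hy => ?_)
  rw [← abs_mul_formSign_symm o η he hy.1, ENNReal.toReal_ofReal (abs_nonneg _)]
  rfl

theorem setLIntegral_enorm_formSign (ho : IsOrientation I o) {η : DiffForm I N k}
    (hη : ContinuousForm η) (he : e ∈ atlas H N) {B : Set N} (hB : MeasurableSet B)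
    (hBe : B ⊆ e.source) :
    ∫⁻ x in B, ‖formSign I o η x‖ₑ ∂(formMeasure I η) =
      ∫⁻ y in (e.extend I).target ∩ (e.extend I).symm ⁻¹' B, ‖chartDensity o η e y‖ₑ := by
  have hS := measurableSet_target_inter_preimage (I := I) (e := e) hB
  have hm := (measurable_formSign ho hη).enorm
  have hsymm : AEMeasurable (e.extend I).symm
      (volume.restrict ((e.extend I).target ∩ (e.extend I).symm ⁻¹' B)) :=
    (e.continuousOn_extend_symm.mono inter_subset_left).aemeasurable hS
  rw [formMeasure_restrict η he hB hBe,
    lintegral_map' hm.aemeasurable (aemeasurable_extend_symm hS inter_subset_left _),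
    lintegral_withDensity_eq_lintegral_mul₀ (aemeasurable_density hη he hB)
      (g := fun y => ‖formSign I o η ((e.extend I).symm y)‖ₑ) (hm.comp_aemeasurable hsymm)]
  refine setLIntegral_congr_fun hS fun y hy => ?_
  rw [← abs_mul_formSign_symm o η he hy.1, enorm_mul, Real.enorm_abs, Pi.mul_apply,
    Real.enorm_eq_ofReal_abs (chartRep I e η y (stdFrame k))]

/-- Used to sum integrals over charts: a countable cover by chart domains is made disjoint. One
point is needed so that the charts can be indexed by all of `ℕ`. -/
theorem exists_chart_partition [Nonempty N] :
    ∃ (c : ℕ → OpenPartialHomeomorph N H) (A : ℕ → Set N), (∀ j, c j ∈ atlas H N) ∧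
      (∀ j, MeasurableSet (A j)) ∧ Pairwise (Function.onFun Disjoint A) ∧
      (∀ j, A j ⊆ (c j).source) ∧ ⋃ j, A j = univ := by
  obtain ⟨s, hs, hsu⟩ := TopologicalSpace.countable_cover_nhds
    (fun x : N => (chartAt H x).open_source.mem_nhds (mem_chart_source H x))
  have hne : s.Nonempty := by
    by_contra h
    rw [not_nonempty_iff_eq_empty] at h
    rw [h, biUnion_empty] at hsu
    exact empty_ne_univ hsu
  obtain ⟨u, rfl⟩ := hs.exists_eq_range hne
  refine ⟨fun j => chartAt H (u j), disjointed fun j => (chartAt H (u j)).source,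
    fun j => chart_mem_atlas H _,
    fun j => MeasurableSet.disjointed (fun j => (chartAt H (u j)).open_source.measurableSet) j,
    disjoint_disjointed _, fun j => disjointed_subset _ j, ?_⟩
  rw [iUnion_disjointed, ← hsu, biUnion_range]

/-- Additivity is not that of the integral over a fixed measure space, as the measure changes with
the form. On each piece of the partition the densities are functions on the same subset of `ℝ^k`,
and there they add up. -/
theorem integrableForm_sum (ho : IsOrientation I o) {ι : Type*} {s : Finset ι}
    {η : ι → DiffForm I N k} (hη : ∀ j ∈ s, ContinuousForm (η j))
    (hi : ∀ j ∈ s, IntegrableForm I o (η j)) : IntegrableForm I o (∑ j ∈ s, η j) := by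
  have hηs := ContinuousForm.sum hη
  refine ⟨(measurable_formSign ho hηs).aestronglyMeasurable, ?_⟩
  rcases isEmpty_or_nonempty N with hN | hN
  · have : formMeasure I (∑ j ∈ s, η j) = 0 := Measure.eq_zero_of_isEmpty _
    rw [this]
    exact hasFiniteIntegral_zero_measure _
  obtain ⟨c, A, hc, hA, hd, hAc, hu⟩ := exists_chart_partition (N := N) (H := H)
  have key : ∀ ζ : DiffForm I N k, ContinuousForm ζ →
      ∫⁻ x, ‖formSign I o ζ x‖ₑ ∂(formMeasure I ζ) =
        ∑' a, ∫⁻ y in ((c a).extend I).target ∩ ((c a).extend I).symm ⁻¹' A a,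
          ‖chartDensity o ζ (c a) y‖ₑ := by
    intro ζ hζ
    rw [← setLIntegral_univ, ← hu, lintegral_iUnion hA hd]
    exact tsum_congr fun a => setLIntegral_enorm_formSign ho hζ (hc a) (hA a) (hAc a)
  have hlt : ∀ j ∈ s, ∫⁻ x, ‖formSign I o (η j) x‖ₑ ∂(formMeasure I (η j)) < ⊤ :=
    fun j hj => (hi j hj).2
  refine lt_of_le_of_lt ?_ (ENNReal.sum_lt_top.2 hlt)
  rw [key _ hηs, Finset.sum_congr rfl fun j hj => key _ (hη j hj),
    ← Summable.tsum_finsetSum fun _ _ => ENNReal.summable]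
  refine ENNReal.tsum_le_tsum fun a => ?_
  rw [← lintegral_finsetSum' s fun j hj => ?_]
  · refine lintegral_mono fun y => ?_
    rw [chartDensity_sum]
    exact enorm_sum_le _ _
  · exact ((((hη j hj).continuousOn_chartDensity ho (hc a)).mono
      inter_subset_left).aemeasurable (measurableSet_target_inter_preimage (hA a))).enorm

/-- As for `integrableForm_sum`, but with signed densities: the series over the pieces converge
because each form is absolutely integrable, and a finite sum of convergent series converges to the
sum of the limits. -/
theorem formIntegral_sum (ho : IsOrientation I o) {ι : Type*} {s : Finset ι}
    {η : ι → DiffForm I N k} (hη : ∀ j ∈ s, ContinuousForm (η j))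
    (hi : ∀ j ∈ s, IntegrableForm I o (η j)) :
    formIntegral I o (∑ j ∈ s, η j) = ∑ j ∈ s, formIntegral I o (η j) := by
  have hηs := ContinuousForm.sum hη
  have his := integrableForm_sum ho hη hi
  rcases isEmpty_or_nonempty N with hN | hN
  · simp [formIntegral, integral_of_isEmpty]
  obtain ⟨c, A, hc, hA, hd, hAc, hu⟩ := exists_chart_partition (N := N) (H := H)
  have key : ∀ ζ : DiffForm I N k, ContinuousForm ζ → IntegrableForm I o ζ →
      HasSum (fun a => ∫ y in ((c a).extend I).target ∩ ((c a).extend I).symm ⁻¹' A a,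
          chartDensity o ζ (c a) y) (formIntegral I o ζ) := by
    intro ζ hζ hiζ
    have h := hasSum_integral_iUnion hA hd (f := formSign I o ζ) (μ := formMeasure I ζ)
      hiζ.integrableOn
    rw [hu, setIntegral_univ] at h
    simp only [setIntegral_formSign ho hζ (hc _) (hA _) (hAc _)] at h
    exact h
  refine (key _ hηs his).unique ?_
  have hsum := hasSum_sum fun j hj => key (η j) (hη j hj) (hi j hj)
  refine hsum.congr_fun fun a => ?_
  rw [← integral_finsetSum s fun j hj => ?_]
  · simp only [chartDensity_sum]
  · exact (integrableOn_formSign_iff ho (hη j hj) (hc a) (hA a) (hAc a)).1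
      (hi j hj).integrableOn

/-- The integral of a form of top degree that vanishes outside a finite disjoint union of domains
of charts. -/
theorem integral_eq_sum_of_disjoint_charts (ho : IsOrientation I o) {η : DiffForm I N k}
    (hη : ContinuousForm η) {ι : Type*} [Fintype ι] {c : ι → OpenPartialHomeomorph N H}
    (hc : ∀ j, c j ∈ atlas H N) (hd : Pairwise (Function.onFun Disjoint fun j => (c j).source))
    (hz : ∀ x, x ∉ ⋃ j, (c j).source → η x = 0)
    (hi : ∀ j, IntegrableOn (chartDensity o η (c j)) ((c j).extend I).target) :
    IntegrableForm I o η ∧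
      formIntegral I o η = ∑ j, ∫ y in ((c j).extend I).target, chartDensity o η (c j) y := by
  have hm : ∀ j, MeasurableSet (c j).source := fun j => (c j).open_source.measurableSet
  have ht : ∀ j, ((c j).extend I).target ∩ ((c j).extend I).symm ⁻¹' (c j).source =
      ((c j).extend I).target := by
    refine fun j => inter_eq_left.2 fun y hy => ?_
    have := ((c j).extend I).map_target hy
    rwa [(c j).extend_source] at this
  have h1 : ∀ j, IntegrableOn (formSign I o η) (c j).source (formMeasure I η) := fun j => by
    rw [integrableOn_formSign_iff ho hη (hc j) (hm j) subset_rfl, ht]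
    exact hi j
  have h2 : IntegrableOn (formSign I o η) (⋃ j, (c j).source) (formMeasure I η) :=
    integrableOn_finite_iUnion.2 h1
  have hz' : ∀ x, x ∉ ⋃ j, (c j).source → formSign I o η x = 0 :=
    fun x hx => formSign_eq_zero (hz x hx)
  refine ⟨(integrableOn_iff_integrable_of_support_subset fun x hx => ?_).1 h2, ?_⟩
  · by_contra h
    exact hx (hz' x h)
  · rw [formIntegral, ← setIntegral_eq_integral_of_forall_compl_eq_zero hz',
      integral_iUnion_fintype hm hd h1]
    refine Finset.sum_congr rfl fun j _ => ?_
    rw [setIntegral_formSign ho hη (hc j) (hm j) subset_rfl, ht]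

end FormMeasure

/-! ### Stokes' theorem on the quadrant. -/

section Quadrant

theorem measurableEmbedding_toLp (m : ℕ) :
    MeasurableEmbedding (WithLp.toLp 2 : (Fin m → ℝ) → EuclideanSpace ℝ (Fin m)) :=
  (MeasurableEquiv.toLp 2 (Fin m → ℝ)).measurableEmbedding

theorem setIntegral_toLp {m : ℕ} (g : EuclideanSpace ℝ (Fin m) → ℝ)
    (S : Set (EuclideanSpace ℝ (Fin m))) :
    ∫ x in WithLp.toLp 2 ⁻¹' S, g (WithLp.toLp 2 x) = ∫ y in S, g y :=
  (PiLp.volume_preserving_toLp (Fin m)).setIntegral_preimage_emb (measurableEmbedding_toLp m) g S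

theorem integrableOn_toLp {m : ℕ} (g : EuclideanSpace ℝ (Fin m) → ℝ)
    (S : Set (EuclideanSpace ℝ (Fin m))) :
    IntegrableOn (fun x => g (WithLp.toLp 2 x)) (WithLp.toLp 2 ⁻¹' S) ↔ IntegrableOn g S :=
  (PiLp.volume_preserving_toLp (Fin m)).integrableOn_comp_preimage (measurableEmbedding_toLp m)

variable {m : ℕ} {g : EuclideanSpace ℝ (Fin m) → ℝ} {R : ℝ}

theorem continuousOn_comp_toLp_Icc (hg : ContinuousOn g {u | ∀ j, 0 ≤ u j}) :
    ContinuousOn (fun x => g (WithLp.toLp 2 x)) (Icc (0 : Fin m → ℝ) fun _ => R) :=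
  hg.comp (PiLp.continuous_toLp 2 _).continuousOn fun _ hx j => hx.1 j

/-- Compactness of the box gives integrability. The passage from `EuclideanSpace` to `Fin m → ℝ`
prepares for the divergence theorem on boxes. -/
theorem integral_quadrant_eq_box (hg : ContinuousOn g {u | ∀ j, 0 ≤ u j})
    (hz : ∀ u, (∃ j, R ≤ u j) → g u = 0) :
    IntegrableOn g {u | ∀ j, 0 ≤ u j} ∧ ∫ u in {u | ∀ j, 0 ≤ u j}, g u =
      ∫ x in Icc (0 : Fin m → ℝ) (fun _ => R), g (WithLp.toLp 2 x) := by
  have hi := (continuousOn_comp_toLp_Icc (R := R) hg).integrableOn_compact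
    (μ := volume) isCompact_Icc
  have hsub : Icc (0 : Fin m → ℝ) (fun _ => R) ⊆ WithLp.toLp 2 ⁻¹' {u | ∀ j, 0 ≤ u j} :=
    fun x hx j => hx.1 j
  have hm : MeasurableSet
      ((WithLp.toLp 2 : (Fin m → ℝ) → EuclideanSpace ℝ (Fin m)) ⁻¹' {u | ∀ j, 0 ≤ u j}) := by
    have : IsClosed {x : Fin m → ℝ | ∀ j, 0 ≤ x j} := by
      simp only [ofPred_forall]
      exact isClosed_iInter fun j => isClosed_le continuous_const (continuous_apply j)
    exact this.measurableSet
  have hdiff : ∀ x ∈ (WithLp.toLp 2 ⁻¹' {u : EuclideanSpace ℝ (Fin m) | ∀ j, 0 ≤ u j}) \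
      Icc (0 : Fin m → ℝ) (fun _ => R), g (WithLp.toLp 2 x) = 0 := by
    rintro x ⟨hx, hxI⟩
    refine hz _ ?_
    by_contra! h
    exact hxI ⟨fun j => hx j, fun j => (h j).le⟩
  rw [← integrableOn_toLp, ← setIntegral_toLp]
  exact ⟨hi.of_forall_sdiff_eq_zero hm hdiff,
    setIntegral_eq_of_subset_of_forall_sdiff_eq_zero hm hsub hdiff⟩

/-- The open faces are parametrized by the open quadrant, where the support need not be compact.
Continuity on the closed quadrant still gives integrability. -/
theorem integral_open_quadrant_eq_box (hg : ContinuousOn g {u | ∀ j, 0 ≤ u j})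
    (hz : ∀ u, (∃ j, R ≤ u j) → g u = 0) :
    IntegrableOn g {u | ∀ j, 0 < u j} ∧ ∫ u in {u | ∀ j, 0 < u j}, g u =
      ∫ x in Icc (0 : Fin m → ℝ) (fun _ => R), g (WithLp.toLp 2 x) := by
  refine ⟨(integral_quadrant_eq_box hg hz).1.mono_set fun u hu j => (hu j).le, ?_⟩
  have hsub : (pi univ fun _ : Fin m => Ioc (0 : ℝ) R) ⊆
      WithLp.toLp 2 ⁻¹' {u | ∀ j, 0 < u j} := fun x hx j => (hx j (mem_univ j)).1
  have hm : MeasurableSet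
      ((WithLp.toLp 2 : (Fin m → ℝ) → EuclideanSpace ℝ (Fin m)) ⁻¹' {u | ∀ j, 0 < u j}) := by
    have : IsOpen {x : Fin m → ℝ | ∀ j, 0 < x j} := by
      simp only [ofPred_forall]
      exact isOpen_iInter_of_finite fun j => isOpen_lt continuous_const (continuous_apply j)
    exact this.measurableSet
  -- In the open quadrant `g` lives on the half-open box, which differs from the closed one by a
  -- null set.
  have hae : (pi univ fun _ : Fin m => Ioc (0 : ℝ) R) =ᵐ[volume]
      Icc (0 : Fin m → ℝ) (fun _ => R) :=
    Measure.univ_pi_Ioc_ae_eq_Icc (f := (0 : Fin m → ℝ)) (g := fun _ => R)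
  rw [← setIntegral_toLp, ← setIntegral_congr_set hae]
  refine setIntegral_eq_of_subset_of_forall_sdiff_eq_zero hm hsub ?_
  rintro x ⟨hx, hxI⟩
  refine hz _ ?_
  by_contra! h
  exact hxI fun j _ => ⟨hx j, (h j).le⟩

variable {n : ℕ}

theorem removeNth_stdFrame (i : Fin (n + 1)) :
    i.removeNth (stdFrame (n + 1)) = fun j => faceIncl i (stdFrame n j) := by
  ext j l
  refine Fin.succAboveCases i ?_ (fun l => ?_) l
  · simp [Fin.removeNth, stdFrame]
  · simp [Fin.removeNth, stdFrame]

variable {β : EuclideanSpace ℝ (Fin (n + 1)) → EuclideanSpace ℝ (Fin (n + 1)) [⋀^Fin n]→L[ℝ] ℝ}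

theorem extDerivWithin_eq_zero_of_notMem {K : Set (EuclideanSpace ℝ (Fin (n + 1)))}
    {s : Set (EuclideanSpace ℝ (Fin (n + 1)))} (hK : IsClosed K) (hz : ∀ y, y ∉ K → β y = 0)
    {y : EuclideanSpace ℝ (Fin (n + 1))} (hy : y ∉ K) : extDerivWithin β s y = 0 := by
  have h : β =ᶠ[𝓝 y] fun _ => 0 := by
    filter_upwards [hK.isOpen_compl.mem_nhds hy] with z hz' using hz z hz'
  rw [h.extDerivWithin_eq_nhds, extDerivWithin, fderivWithin_const_apply]
  exact map_zero (ContinuousAlternatingMap.alternatizeUncurryFinCLM ℝ _ ℝ)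

/-- Stokes' theorem on the quadrant. -/
theorem stokes_quadrant (hβ : ContDiffOn ℝ ∞ β (range (QModel (n + 1))))
    {K : Set (EuclideanSpace ℝ (Fin (n + 1)))} (hK : IsCompact K) (hz : ∀ y, y ∉ K → β y = 0) :
    IntegrableOn (fun y => extDerivWithin β (range (QModel (n + 1))) y (stdFrame (n + 1)))
        (range (QModel (n + 1))) ∧
      (∀ i : Fin (n + 1), IntegrableOn (fun u => β (faceIncl i u) fun j =>
        faceIncl i (stdFrame n j)) {u | ∀ j, 0 < u j}) ∧
      ∫ y in range (QModel (n + 1)),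
          extDerivWithin β (range (QModel (n + 1))) y (stdFrame (n + 1)) =
        ∑ i : Fin (n + 1), (-1) ^ (i.val + 1) * ∫ u in {u | ∀ j, 0 < u j},
          β (faceIncl i u) fun j => faceIncl i (stdFrame n j) := by
  set Q := range (QModel (n + 1)) with hQ
  have hQ' : Q = {y | ∀ i, 0 ≤ y i} := range_qModel (n + 1)
  have hu : UniqueDiffOn ℝ Q := (QModel (n + 1)).uniqueDiffOn
  -- The bound is strict, so that the faces `x_i = R` of the box miss `K`.
  obtain ⟨R, hR0, hR⟩ : ∃ R : ℝ, 0 < R ∧ ∀ y ∈ K, ∀ i, y i < R := by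
    obtain ⟨C, hC⟩ := hK.isBounded.exists_norm_le
    refine ⟨max C 0 + 1, by positivity, fun y hy i => ?_⟩
    have h1 : |y i| ≤ ‖y‖ := by simpa using PiLp.norm_apply_le y i
    have := le_abs_self (y i)
    have := hC y hy
    have := le_max_left C 0
    linarith
  have hzR : ∀ y : EuclideanSpace ℝ (Fin (n + 1)), (∃ i, R ≤ y i) → y ∉ K :=
    fun y ⟨i, hi⟩ hy => absurd (hR y hy i) (not_lt.2 hi)
  have hdc : ContinuousOn (fun y => extDerivWithin β Q y (stdFrame (n + 1))) Q :=
    (ContinuousAlternatingMap.apply ℝ _ ℝ (stdFrame (n + 1))).continuous.comp_continuousOn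
      ((ContinuousAlternatingMap.alternatizeUncurryFinCLM ℝ _ ℝ).continuous.comp_continuousOn
        (hβ.continuousOn_fderivWithin hu (by simp)))
  have hbox := integral_quadrant_eq_box (R := R)
    (g := fun y => extDerivWithin β Q y (stdFrame (n + 1))) (by rw [← hQ']; exact hdc)
    (fun y hy => by rw [extDerivWithin_eq_zero_of_notMem hK.isClosed hz (hzR y hy)]; rfl)
  rw [← hQ'] at hbox
  have hface : ∀ i : Fin (n + 1), _ := fun i =>
    integral_open_quadrant_eq_box (R := R)
      (g := fun u => β (faceIncl i u) fun j => faceIncl i (stdFrame n j))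
      ((ContinuousAlternatingMap.apply ℝ _ ℝ _).continuous.comp_continuousOn
        (hβ.continuousOn.comp (faceIncl i).continuous.continuousOn fun u hu => by
          rw [hQ']
          intro l
          refine Fin.succAboveCases i ?_ (fun l => ?_) l
          · simp
          · simpa using hu l))
      (fun u ⟨j, hj⟩ => by rw [hz _ (hzR _ ⟨i.succAbove j, by simpa using hj⟩)]; rfl)
  refine ⟨hbox.1, fun i => (hface i).1, ?_⟩
  rw [hbox.2]
  simp only [(hface _).2]
  let L : (Fin (n + 1) → ℝ) →L[ℝ] EuclideanSpace ℝ (Fin (n + 1)) :=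
    (PiLp.continuousLinearEquiv 2 ℝ (fun _ : Fin (n + 1) => ℝ)).symm.toContinuousLinearMap
  let v : Fin (n + 1) → Fin n → EuclideanSpace ℝ (Fin (n + 1)) :=
    fun i j => faceIncl i (stdFrame n j)
  have hfd : ∀ i, ∀ y ∈ Q, DifferentiableWithinAt ℝ (fun y => β y (v i)) Q y := fun i y hy =>
    (ContinuousAlternatingMap.apply ℝ _ ℝ (v i)).differentiableAt.comp_differentiableWithinAt y
      ((hβ y hy).differentiableWithinAt (by simp))
  have hfc : ∀ i, ContinuousOn (fun y => β y (v i)) Q := fun i y hy =>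
    (hfd i y hy).continuousWithinAt
  have hQbox : ∀ x ∈ Icc (0 : Fin (n + 1) → ℝ) (fun _ => R), L x ∈ Q := fun x hx => by
    rw [hQ']; exact fun j => hx.1 j
  -- The vector field whose divergence is the coefficient of `dβ`: up to the sign `(-1)^i`, its
  -- `i`-th component is `β` on the coordinate frame without the `i`-th vector.
  let f : Fin (n + 1) → (Fin (n + 1) → ℝ) → ℝ := fun i x => (-1) ^ i.val * β (L x) (v i)
  let f' : Fin (n + 1) → (Fin (n + 1) → ℝ) → (Fin (n + 1) → ℝ) →L[ℝ] ℝ := fun i x =>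
    ((-1 : ℝ) ^ i.val) • (fderivWithin ℝ (fun y => β y (v i)) Q (L x)).comp L
  have hdiv : EqOn (fun x => extDerivWithin β Q (WithLp.toLp 2 x) (stdFrame (n + 1)))
      (fun x => ∑ i, f' i x (Pi.single i 1)) (Icc (0 : Fin (n + 1) → ℝ) fun _ => R) := by
    intro x hx
    have hy := hQbox x hx
    refine (extDerivWithin_apply ((hβ _ hy).differentiableWithinAt (by simp)) (hu _ hy) _).trans ?_
    refine Finset.sum_congr rfl fun i _ => ?_
    rw [removeNth_stdFrame]
    have hL : L (Pi.single i 1) = stdFrame (n + 1) i := by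
      ext l; simp [L, stdFrame]
    simp only [f', smul_apply, ContinuousLinearMap.comp_apply, hL]
    simp [v, L]
  have hstokes := integral_divergence_of_hasFDerivAt_off_countable' (E := ℝ)
    (0 : Fin (n + 1) → ℝ) (fun _ => R) (fun _ => hR0.le) f f' ∅ countable_empty
    (fun i => continuousOn_const.mul
      ((hfc i).comp L.continuous.continuousOn hQbox))
    (fun x hx i => by
      -- The divergence theorem asks for derivatives only inside the box, where the quadrant is a
      -- neighbourhood and the derivative within it is a full derivative.
      have hxQ : Q ∈ 𝓝 (L x) := by
        have h1 : L x ∈ interior Q := by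
          rw [hQ, interior_range_qModel]
          exact fun j => (hx.1 j (mem_univ j)).1
        exact mem_interior_iff_mem_nhds.1 h1
      have h2 : HasFDerivAt (fun y => β y (v i)) (fderivWithin ℝ (fun y => β y (v i)) Q (L x))
          (L x) := (hfd i _ (mem_of_mem_nhds hxQ)).hasFDerivWithinAt.hasFDerivAt hxQ
      exact (h2.comp x L.hasFDerivAt).const_mul _)
    (by
      refine IntegrableOn.congr_fun ?_ hdiv measurableSet_Icc
      refine (continuousOn_comp_toLp_Icc (R := R)
        (g := fun y => extDerivWithin β Q y (stdFrame (n + 1))) ?_).integrableOn_compact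
          isCompact_Icc
      rw [← hQ']
      exact hdc)
  rw [setIntegral_congr_fun measurableSet_Icc hdiv]
  refine hstokes.trans (Finset.sum_congr rfl fun i _ => ?_)
  have hfront : ∀ x : Fin n → ℝ, f i (i.insertNth R x) = 0 := fun x => by
    have h1 : L (i.insertNth R x) ∉ K := hzR _ ⟨i, by simp [L]⟩
    simp only [f, hz _ h1]
    simp
  -- The back face enters the divergence theorem with a minus sign, which turns `(-1)^i` into
  -- `(-1)^(i+1)`.
  have hback : ∀ x : Fin n → ℝ, f i (i.insertNth (0 : ℝ) x) =
      (-1) ^ i.val * β (faceIncl i (WithLp.toLp 2 x)) (v i) := fun x => rfl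
  simp only [hfront, Pi.zero_apply, hback, integral_zero, zero_sub, integral_const_mul, pow_succ,
    mul_neg, mul_one, neg_mul]
  rfl

end Quadrant

theorem mfderiv_extend_coordChange {E : Type*} [NormedAddCommGroup E] [NormedSpace ℝ E]
    {H : Type*} [TopologicalSpace H] {I : ModelWithCorners ℝ E H}
    {M : Type*} [TopologicalSpace M] [ChartedSpace H M] [IsManifold I ∞ M]
    {e e' : OpenPartialHomeomorph M H} (he : e ∈ atlas H M) (he' : e' ∈ atlas H M)
    {x : M} (hx : x ∈ e.source) (hx' : x ∈ e'.source) (v : TangentSpace I x) :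
    (mfderiv I 𝓘(ℝ, E) (e'.extend I) x v : E) =
      fderivWithin ℝ (I.extendCoordChange e e') (range I) (e.extend I x)
        (mfderiv I 𝓘(ℝ, E) (e.extend I) x v : E) := by
  have h1 := (mdifferentiableAt_extend (I := I) he hx).hasMFDerivAt
  have h2 : HasMFDerivWithinAt 𝓘(ℝ, E) 𝓘(ℝ, E) (I.extendCoordChange e e') (range I)
      (e.extend I x) (fderivWithin ℝ (I.extendCoordChange e e') (range I) (e.extend I x)) :=
    ((contDiffWithinAt_coordChange he he'
      (extend_mem_extendCoordChange_source hx hx')).differentiableWithinAt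
        (by simp)).hasFDerivWithinAt.hasMFDerivWithinAt
  have h3 := (h2.comp x h1.hasMFDerivWithinAt (s := univ) fun z _ => mem_range_self _)
  rw [hasMFDerivWithinAt_univ] at h3
  have h4 : e'.extend I =ᶠ[𝓝 x] I.extendCoordChange e e' ∘ e.extend I := by
    filter_upwards [e.open_source.mem_nhds hx] with z hz
    exact congrArg (e'.extend I) ((e.extend I).left_inv (by rwa [e.extend_source])).symm
  exact congrArg (fun T : E →L[ℝ] E => T v) (h3.congr_of_eventuallyEq h4).mfderiv

/-! ### Corners of codimension one under changes of charts. -/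

section Corners

variable {n : ℕ} {M : Type*} [TopologicalSpace M] [ChartedSpace (EuclideanQuadrant (n + 1)) M]
  [IsManifold (QModel (n + 1)) ∞ M] {e e' : OpenPartialHomeomorph M (EuclideanQuadrant (n + 1))}
  {i j : Fin (n + 1)} {x : M}

/-- The differential of a change of charts maps the inward half-space at a point of codimension
one to the inward half-space of every face on which this point lies. -/
theorem IsFaceChart.fderivWithin_nonneg (h : IsFaceChart e i x)
    (he' : e' ∈ atlas (EuclideanQuadrant (n + 1)) M) (hx' : x ∈ e'.source)
    (hj : (e' x).1 j = 0) {v : EuclideanSpace ℝ (Fin (n + 1))} (hv : 0 ≤ v i) :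
    0 ≤ fderivWithin ℝ ((QModel (n + 1)).extendCoordChange e e') (range (QModel (n + 1)))
      (e.extend (QModel (n + 1)) x) v j := by
  set y := e.extend (QModel (n + 1)) x with hy
  set φ := (QModel (n + 1)).extendCoordChange e e' with hφ
  have hd : HasFDerivWithinAt φ (fderivWithin ℝ φ (range (QModel (n + 1))) y)
      (range (QModel (n + 1))) y :=
    ((contDiffWithinAt_coordChange h.mem_atlas he'
      (extend_mem_extendCoordChange_source h.mem_source hx')).differentiableWithinAt
        (by simp)).hasFDerivWithinAt
  have hd2 : HasFDerivWithinAt (fun z => φ z j)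
      ((EuclideanSpace.proj j : EuclideanSpace ℝ (Fin (n + 1)) →L[ℝ] ℝ).comp
        (fderivWithin ℝ φ (range (QModel (n + 1))) y)) (range (QModel (n + 1))) y :=
    (EuclideanSpace.proj j : EuclideanSpace ℝ (Fin (n + 1)) →L[ℝ] ℝ).hasFDerivAt
      |>.comp_hasFDerivWithinAt y hd
  have hφy : φ y j = 0 := by
    have : φ y = (e' x).1 :=
      congrArg (e'.extend (QModel (n + 1)))
        ((e.extend (QModel (n + 1))).left_inv (by rw [e.extend_source]; exact h.mem_source))
    rw [this, hj]
  -- The `j`-th coordinate of the change of charts is nonnegative on the quadrant and vanishes at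
  -- `y`, so its derivative is nonnegative in tangent directions.
  have hmin : IsLocalMinOn (fun z => φ z j) (range (QModel (n + 1))) y := by
    filter_upwards [self_mem_nhdsWithin] with z hz
    rw [hφy]
    have h1 : φ z ∈ range (QModel (n + 1)) := extendCoordChange_mapsTo hz
    rw [range_qModel] at h1
    exact h1 j
  refine hmin.hasFDerivWithinAt_nonneg hd2 (mem_posTangentConeAt_of_frequently_mem ?_)
  -- For small `t > 0` the point `y + t • v` stays in the quadrant: its `i`-th coordinate is `t * v
  -- i`, and the other coordinates of `y` are positive.
  refine Eventually.frequently ?_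
  rw [range_qModel]
  simp only [mem_ofPred_eq]
  rw [eventually_all]
  intro l
  have hyl : y l = (e x).1 l := rfl
  rcases eq_or_ne l i with rfl | hl
  · filter_upwards [self_mem_nhdsWithin] with t ht
    have : y l = 0 := (h.eq_zero_iff l).2 rfl
    simp only [PiLp.add_apply, PiLp.smul_apply, smul_eq_mul, this, zero_add]
    exact mul_nonneg (le_of_lt ht) hv
  · have hpos : 0 < y l := lt_of_le_of_ne ((e x).2 l) fun h0 => hl ((h.eq_zero_iff l).1 h0.symm)
    have hc : ContinuousAt (fun t : ℝ => (y + t • v) l) 0 := by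
      simp only [PiLp.add_apply, PiLp.smul_apply, smul_eq_mul]
      fun_prop
    have h2 := hc.tendsto.eventually_const_lt (u := 0) (by simpa using hpos)
    filter_upwards [nhdsWithin_le_nhds h2] with t ht using le_of_lt ht

/-- A corner of codimension one lies on exactly one coordinate hyperplane in every chart. -/
theorem isFaceChart_of_mem_stratum (hx : x ∈ stratum (n + 1) M 1)
    (he : e ∈ atlas (EuclideanQuadrant (n + 1)) M) (hxe : x ∈ e.source) :
    ∃ i, IsFaceChart e i x := by
  obtain ⟨e₀, i₀, h₀⟩ := exists_isFaceChart hx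
  obtain ⟨i, hi⟩ : ∃ i, (e x).1 i = 0 := by
    by_contra! h
    exact h 0 (eq_zero_of_mem_stratum hx he hxe fun j =>
      lt_of_le_of_ne ((e x).2 _) (h _).symm)
  refine ⟨i, he, hxe, fun j => ⟨fun hj => ?_, fun hj => hj ▸ hi⟩⟩
  set D := fderivWithin ℝ ((QModel (n + 1)).extendCoordChange e₀ e) (range (QModel (n + 1)))
    (e₀.extend (QModel (n + 1)) x) with hD
  have hsurj : ∀ w, ∃ v, D v = w := fun w => by
    obtain ⟨v, hv⟩ := (dChart_bijective he hxe).2 w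
    exact ⟨_, (mfderiv_extend_coordChange h₀.mem_atlas he h₀.mem_source hxe v).symm.trans hv⟩
  -- On the hyperplane `v i₀ = 0` the half-space property applies to both `w` and `-w`, so the
  -- `l`-th component of `D` vanishes there and depends on `v i₀` alone.
  have key : ∀ l, (e x).1 l = 0 → ∀ v, D v l = v i₀ * D (EuclideanSpace.single i₀ 1) l := by
    intro l hl v
    set w := v - v i₀ • EuclideanSpace.single i₀ (1 : ℝ) with hw
    have hw0 : w i₀ = 0 := by simp [hw]
    have h1 : 0 ≤ D w l := h₀.fderivWithin_nonneg he hxe hl hw0.ge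
    have h2 : 0 ≤ D (-w) l := h₀.fderivWithin_nonneg he hxe hl (by simp [hw0])
    rw [map_neg, PiLp.neg_apply] at h2
    have h3 : D w l = 0 := le_antisymm (by linarith) h1
    rw [hw, map_sub, map_smul, PiLp.sub_apply, PiLp.smul_apply, smul_eq_mul] at h3
    linarith
  -- Two vanishing coordinates `i ≠ j` would make two components of `D` multiples of the same
  -- functional, so `D` could not reach both basis vectors.
  by_contra hne
  obtain ⟨v, hv⟩ := hsurj (EuclideanSpace.single i 1)
  obtain ⟨v', hv'⟩ := hsurj (EuclideanSpace.single j 1)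
  have h1 := key i hi v
  have h2 := key j hj v
  have h3 := key j hj v'
  rw [hv] at h1 h2
  rw [hv'] at h3
  simp [hne] at h1 h2 h3
  rcases h2 with h2 | h2
  · simp [h2] at h1
  · simp [h2] at h3

/-- The outward vectors are the same in all charts. -/
theorem IsOutward.dChart_neg {x : stratum (n + 1) M 1}
    {v : TangentSpace (QModel (n + 1)) (incl n M x)} (hv : IsOutward x v)
    (h : IsFaceChart e i (incl n M x)) : dChart e (incl n M x) v i < 0 := by
  obtain ⟨e', i', h', hneg⟩ := hv
  by_contra! hi
  have h1 := h.fderivWithin_nonneg h'.mem_atlas h'.mem_source ((h'.eq_zero_iff i').2 rfl) hi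
  have h2 := mfderiv_extend_coordChange h.mem_atlas h'.mem_atlas h.mem_source h'.mem_source v
  have h3 : 0 ≤ dChart e' (incl n M x) v i' := by
    refine h1.trans (le_of_eq ?_)
    exact congrArg (fun w : EuclideanSpace ℝ (Fin (n + 1)) => w i') h2.symm
  exact absurd hneg (not_lt.2 h3)

end Corners

/-! ### Signs of frames adapted to a face. -/

section FrameSign

/-- The representative chosen by `someVector` is a positive multiple of `ψ`, and signs do not see
the factor. -/
theorem frameSign_rayOfNeZero {k : ℕ} {V : Type*} [AddCommGroup V] [Module ℝ V]
    {ψ : V [⋀^Fin k]→ₗ[ℝ] ℝ} (hψ : ψ ≠ 0) (w : Fin k → V) :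
    frameSign (rayOfNeZero ℝ ψ hψ) w = SignType.sign (ψ w) := by
  have h1 : SameRay ℝ (Module.Ray.someVector (rayOfNeZero ℝ ψ hψ)) ψ := by
    rw [← ray_eq_iff (Module.Ray.someVector_ne_zero _) hψ]
    exact Module.Ray.someVector_ray _
  obtain ⟨r₁, r₂, hr₁, hr₂, hr⟩ := h1.exists_pos (Module.Ray.someVector_ne_zero _) hψ
  have h2 := congrArg (fun T => SignType.sign (T w)) hr
  simp only [AlternatingMap.smul_apply, smul_eq_mul, sign_mul, sign_pos hr₁, sign_pos hr₂,
    one_mul] at h2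
  exact h2

theorem eq_sum_smul_stdFrame {m : ℕ} (a : EuclideanSpace ℝ (Fin m)) :
    a = ∑ l, a l • stdFrame m l := by
  ext j
  simp [stdFrame, Pi.single_apply]

/-- The value of a form of top degree on a frame of the `i`-th coordinate hyperplane, with a vector
put in front. -/
theorem topForm_cons_face {n : ℕ} (Φ : EuclideanSpace ℝ (Fin (n + 1)) [⋀^Fin (n + 1)]→ₗ[ℝ] ℝ)
    (i : Fin (n + 1)) (a : EuclideanSpace ℝ (Fin (n + 1))) :
    Φ (Matrix.vecCons a fun j => faceIncl i (stdFrame n j)) =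
      a i * ((-1) ^ i.val * Φ (stdFrame (n + 1))) := by
  -- A basis vector of the face put in front occurs twice, so only the `i`-th component of `a`
  -- counts.
  have h2 : ∀ j : Fin n, Φ (Matrix.vecCons (stdFrame (n + 1) (i.succAbove j))
      fun j => faceIncl i (stdFrame n j)) = 0 := by
    intro j
    refine Φ.map_eq_zero_of_eq _ (i := 0) (j := j.succ) ?_ (Fin.succ_ne_zero j).symm
    have := congrFun (removeNth_stdFrame i) j
    simpa [Fin.removeNth] using this
  have h3 : Φ (Matrix.vecCons (stdFrame (n + 1) i) fun j => faceIncl i (stdFrame n j)) =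
      (-1) ^ i.val * Φ (stdFrame (n + 1)) := by
    -- Moving the front vector to the `i`-th place passes it over `i` vectors.
    have h4 := Φ.neg_one_pow_smul_map_insertNth i (stdFrame (n + 1) i)
      (i.removeNth (stdFrame (n + 1)))
    rw [Fin.insertNth_self_removeNth, removeNth_stdFrame] at h4
    rw [← h4]
    simp
  let ℓ : EuclideanSpace ℝ (Fin (n + 1)) →ₗ[ℝ] ℝ :=
    { toFun := fun b => Φ.curryLeft b fun j => faceIncl i (stdFrame n j)
      map_add' := fun b c => by rw [map_add, AlternatingMap.add_apply]
      map_smul' := fun r b => by rw [map_smul, AlternatingMap.smul_apply, RingHom.id_apply] }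
  have h5 : ∀ b, ℓ b = Φ (Matrix.vecCons b fun j => faceIncl i (stdFrame n j)) := fun b => rfl
  rw [← h5]
  conv_lhs => rw [eq_sum_smul_stdFrame a]
  rw [map_sum, Fin.sum_univ_succAbove _ i]
  simp only [LinearMap.map_smul]
  simp only [h5, h2, h3, mul_zero, Finset.sum_const_zero, add_zero, smul_eq_mul]

end FrameSign

/-! ### The inclusion and the boundary orientation in face charts. -/

section FaceCharts

variable {n : ℕ} {M : Type*} [TopologicalSpace M] [ChartedSpace (EuclideanQuadrant (n + 1)) M]
  [IsManifold (QModel (n + 1)) ∞ M] {e : OpenPartialHomeomorph M (EuclideanQuadrant (n + 1))}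
  {i : Fin (n + 1)} {x₀ : stratum (n + 1) M 1} {he : e ∈ atlas (EuclideanQuadrant (n + 1)) M}
  {u : EuclideanSpace ℝ (Fin n)}

theorem faceChart_extend_target :
    ((faceChart e i x₀ he).extend (𝓡 n)).target = faceTarget e i := by
  rw [OpenPartialHomeomorph.extend_target]
  simp [faceChart]

theorem incl_faceChart_symm (hu : u ∈ faceTarget e i) :
    incl n M (((faceChart e i x₀ he).extend (𝓡 n)).symm u) =
      (e.extend (QModel (n + 1))).symm (faceIncl i u) :=
  faceChart_symm_val e i x₀ he hu

theorem isOpen_faceTarget (x₀ : stratum (n + 1) M 1)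
    (he : e ∈ atlas (EuclideanQuadrant (n + 1)) M) : IsOpen (faceTarget e i) :=
  (faceChart e i x₀ he).open_target

/-- The inclusion of `∂¹M` in a face chart. -/
theorem dIncl_dChartSymm (hu : u ∈ faceTarget e i) (v : EuclideanSpace ℝ (Fin n)) :
    (dIncl (((faceChart e i x₀ he).extend (𝓡 n)).symm u)
      (dChartSymm (𝓡 n) (faceChart e i x₀ he) u v) : EuclideanSpace ℝ (Fin (n + 1))) =
      dChartSymm (QModel (n + 1)) e (faceIncl i u) (faceIncl i v) := by
  set c := faceChart e i x₀ he with hc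
  have hca : c ∈ atlas (EuclideanSpace ℝ (Fin n)) (stratum (n + 1) M 1) :=
    faceChart_mem_atlas e i x₀ he
  have hut : u ∈ (c.extend (𝓡 n)).target := by rwa [faceChart_extend_target]
  have h1 := mdifferentiableWithinAt_extend_symm (I := 𝓡 n) hca hut
  have h2 : MDifferentiableAt (𝓡 n) (QModel (n + 1)) (incl n M) ((c.extend (𝓡 n)).symm u) :=
    (contMDiff_incl _).mdifferentiableAt (by simp)
  have h3 := mdifferentiableWithinAt_extend_symm (I := QModel (n + 1)) he hu.2
  have h4 : HasMFDerivAt 𝓘(ℝ, EuclideanSpace ℝ (Fin n)) 𝓘(ℝ, EuclideanSpace ℝ (Fin (n + 1)))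
      (faceIncl i) u (faceIncl i) := (faceIncl i).hasMFDerivAt
  have hL := h2.hasMFDerivAt.comp_hasMFDerivWithinAt u h1.hasMFDerivWithinAt
  have hR := h3.hasMFDerivWithinAt.comp u (h4.hasMFDerivWithinAt (s := faceTarget e i))
    fun z hz => extend_target_subset hz.2
  have hnhds : faceTarget e i ∈ 𝓝 u := (isOpen_faceTarget x₀ he).mem_nhds hu
  have hL' := hL.hasMFDerivAt (by simp)
  have hR' := hR.hasMFDerivAt hnhds
  have heq : incl n M ∘ (c.extend (𝓡 n)).symm =ᶠ[𝓝 u]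
      (e.extend (QModel (n + 1))).symm ∘ faceIncl i := by
    filter_upwards [hnhds] with z hz
    exact incl_faceChart_symm hz
  have h5 := hasMFDerivAt_unique hL' (hR'.congr_of_eventuallyEq heq)
  exact congrArg (fun T : EuclideanSpace ℝ (Fin n) →L[ℝ] EuclideanSpace ℝ (Fin (n + 1)) => T v) h5

theorem chartRep_pullback_incl {k : ℕ} (α : DiffForm (QModel (n + 1)) M k)
    (hu : u ∈ faceTarget e i) :
    chartRep (𝓡 n) (faceChart e i x₀ he) (pullback (QModel (n + 1)) (𝓡 n) (incl n M) α) u =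
      (chartRep (QModel (n + 1)) e α (faceIncl i u)).compContinuousLinearMap (faceIncl i) := by
  ext v
  have h1 := congrArg (β := EuclideanSpace ℝ (Fin (n + 1)) [⋀^Fin k]→L[ℝ] ℝ) (fun x => α x)
    (incl_faceChart_symm (x₀ := x₀) (he := he) hu)
  have h2 : (fun j => (dIncl (((faceChart e i x₀ he).extend (𝓡 n)).symm u)
      (dChartSymm (𝓡 n) (faceChart e i x₀ he) u (v j)) : EuclideanSpace ℝ (Fin (n + 1)))) =
      fun j => dChartSymm (QModel (n + 1)) e (faceIncl i u) (faceIncl i (v j)) :=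
    funext fun j => dIncl_dChartSymm hu (v j)
  exact (congrArg (fun w => (α (incl n M (((faceChart e i x₀ he).extend (𝓡 n)).symm u)) :
      EuclideanSpace ℝ (Fin (n + 1)) [⋀^Fin k]→L[ℝ] ℝ) w) h2).trans
    (congrArg (fun T : EuclideanSpace ℝ (Fin (n + 1)) [⋀^Fin k]→L[ℝ] ℝ => T _) h1)

theorem continuousForm_pullback_incl {k : ℕ} {α : DiffForm (QModel (n + 1)) M k}
    (hα : ContinuousForm α) :
    ContinuousForm (pullback (QModel (n + 1)) (𝓡 n) (incl n M) α) := by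
  rintro _ ⟨e, i, x₀, he, rfl⟩
  rw [faceChart_extend_target]
  refine ContinuousOn.congr ?_ fun u hu => chartRep_pullback_incl α hu
  exact (ContinuousAlternatingMap.compContinuousLinearMapCLM (faceIncl i)).continuous
    |>.comp_continuousOn
      ((hα e he).comp (faceIncl i).continuous.continuousOn fun u hu => hu.2)

/-- The sign of the coordinate frame of a face chart for the boundary orientation. -/
theorem frameSign_boundaryOrientation (o : PointwiseOrientation (QModel (n + 1)) M)
    (hu : u ∈ faceTarget e i) :
    frameSign (boundaryOrientation o (((faceChart e i x₀ he).extend (𝓡 n)).symm u))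
        (fun j => dChartSymm (𝓡 n) (faceChart e i x₀ he) u (stdFrame n j)) =
      SignType.sign ((-1 : ℝ) ^ (i.val + 1)) *
        frameSign (o ((e.extend (QModel (n + 1))).symm (faceIncl i u)))
          (fun j => dChartSymm (QModel (n + 1)) e (faceIncl i u) (stdFrame (n + 1) j)) := by
  set x := ((faceChart e i x₀ he).extend (𝓡 n)).symm u with hx
  have hval : incl n M x = (e.extend (QModel (n + 1))).symm (faceIncl i u) :=
    incl_faceChart_symm hu
  have hface : IsFaceChart e i (incl n M x) := hval ▸ isFaceChart_of_mem_faceTarget he hu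
  set ν := (exists_isOutward x).choose with hν
  have hνo : IsOutward x ν := (exists_isOutward x).choose_spec
  set a : EuclideanSpace ℝ (Fin (n + 1)) := dChart e (incl n M x) ν with ha
  -- The vector `ν` was chosen with some face chart of its own; being outward does not depend on it.
  have hai : a i < 0 := hνo.dChart_neg hface
  let d : EuclideanSpace ℝ (Fin (n + 1)) →ₗ[ℝ] EuclideanSpace ℝ (Fin (n + 1)) :=
    (dChartSymm (QModel (n + 1)) e (faceIncl i u)).toLinearMap
  have hda : d a = ν := by
    apply (dChart_bijective he hface.mem_source).1
    have h1 := mfderiv_extend_comp_dChartSymm_self (I := QModel (n + 1)) he hu.2 a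
    rw [← hval] at h1
    exact h1
  let φ : EuclideanSpace ℝ (Fin (n + 1)) [⋀^Fin (n + 1)]→ₗ[ℝ] ℝ := (o (incl n M x)).someVector
  have hφ : φ = (o ((e.extend (QModel (n + 1))).symm (faceIncl i u))).someVector :=
    congrArg (β := EuclideanSpace ℝ (Fin (n + 1)) [⋀^Fin (n + 1)]→ₗ[ℝ] ℝ)
      (fun z => (o z).someVector) hval
  have h2 := topForm_cons_face (φ.compLinearMap d) i a
  have h3 : (φ.compLinearMap d) (Matrix.vecCons a fun j => faceIncl i (stdFrame n j)) =
      (((o (incl n M x)).someVector.curryLeft ν).compLinearMap (dIncl x).toLinearMap)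
        (fun j => dChartSymm (𝓡 n) (faceChart e i x₀ he) u (stdFrame n j)) := by
    refine congrArg φ (funext fun j => ?_)
    refine Fin.cases ?_ (fun j => ?_) j
    · exact hda
    · exact (dIncl_dChartSymm hu (stdFrame n j)).symm
  refine (frameSign_rayOfNeZero _ _).trans ?_
  -- One factor `-1` comes from `a i < 0`, the other `i` from reordering the frame.
  rw [← h3, h2, ← mul_assoc, sign_mul, sign_mul, sign_neg hai, pow_succ, sign_mul]
  congr 1
  · simp
  · exact congrArg (fun T : EuclideanSpace ℝ (Fin (n + 1)) [⋀^Fin (n + 1)]→ₗ[ℝ] ℝ =>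
      SignType.sign (T fun j => d (stdFrame (n + 1) j))) hφ

theorem coe_sign_neg_one_pow (l : ℕ) :
    ((SignType.sign ((-1 : ℝ) ^ l) : SignType) : ℝ) = (-1) ^ l := by
  rcases neg_one_pow_eq_or ℝ l with h | h <;> simp [h]

theorem chartSign_boundaryOrientation (o : PointwiseOrientation (QModel (n + 1)) M)
    (hu : u ∈ faceTarget e i) :
    chartSign (boundaryOrientation o) (faceChart e i x₀ he) u =
      (-1) ^ (i.val + 1) * chartSign o e (faceIncl i u) := by
  rw [chartSign, frameSign_boundaryOrientation o hu, SignType.coe_mul, coe_sign_neg_one_pow]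
  rfl

theorem isOrientation_boundaryOrientation {o : PointwiseOrientation (QModel (n + 1)) M}
    (ho : IsOrientation (QModel (n + 1)) o) : IsOrientation (𝓡 n) (boundaryOrientation o) := by
  rintro _ ⟨e, i, x₀, he, rfl⟩ u hu
  rw [faceChart_extend_target] at hu ⊢
  have h1 : Tendsto (faceIncl i) (𝓝[faceTarget e i] u)
      (𝓝[(e.extend (QModel (n + 1))).target] (faceIncl i u)) :=
    (faceIncl i).continuous.continuousWithinAt.tendsto_nhdsWithin fun z hz => hz.2
  filter_upwards [h1.eventually (ho e he _ hu.2), self_mem_nhdsWithin] with z hz hzt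
  rw [frameSign_boundaryOrientation o hu, frameSign_boundaryOrientation o hzt, hz]

end FaceCharts

/-! ### Stokes' theorem in one chart, and decomposition of forms. -/

section Stokes

variable {n : ℕ} {M : Type*} [TopologicalSpace M] [ChartedSpace (EuclideanQuadrant (n + 1)) M]
  {e : OpenPartialHomeomorph M (EuclideanQuadrant (n + 1))}
  {o : PointwiseOrientation (QModel (n + 1)) M} {α : DiffForm (QModel (n + 1)) M n}

/-- The form `α` in the chart `e`, multiplied by the sign of this chart and extended by zero. -/
def signedRep (o : PointwiseOrientation (QModel (n + 1)) M) (α : DiffForm (QModel (n + 1)) M n)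
    (e : OpenPartialHomeomorph M (EuclideanQuadrant (n + 1)))
    (y : EuclideanSpace ℝ (Fin (n + 1))) : EuclideanSpace ℝ (Fin (n + 1)) [⋀^Fin n]→L[ℝ] ℝ :=
  (e.extend (QModel (n + 1))).target.indicator
    (fun y => chartSign o e y • chartRep (QModel (n + 1)) e α y) y

theorem signedRep_of_mem {y : EuclideanSpace ℝ (Fin (n + 1))}
    (hy : y ∈ (e.extend (QModel (n + 1))).target) :
    signedRep o α e y = chartSign o e y • chartRep (QModel (n + 1)) e α y :=
  indicator_of_mem hy _

theorem signedRep_of_notMem {y : EuclideanSpace ℝ (Fin (n + 1))}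
    (hy : y ∉ (e.extend (QModel (n + 1))).target) : signedRep o α e y = 0 :=
  indicator_of_notMem hy _

theorem signedRep_eq_zero {y : EuclideanSpace ℝ (Fin (n + 1))}
    (hy : y ∉ e.extend (QModel (n + 1)) '' closure {x : M | α x ≠ 0}) :
    signedRep o α e y = 0 := by
  by_cases hyt : y ∈ (e.extend (QModel (n + 1))).target
  · rw [signedRep_of_mem hyt, chartRep_eq_zero, smul_zero]
    exact eq_zero_of_notMem_closure fun h =>
      hy ⟨_, h, (e.extend (QModel (n + 1))).right_inv hyt⟩
  · exact signedRep_of_notMem hyt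

theorem isCompact_extend_image (hc : CompactlySupported (QModel (n + 1)) α)
    (hs : closure {x : M | α x ≠ 0} ⊆ e.source) :
    IsCompact (e.extend (QModel (n + 1)) '' closure {x : M | α x ≠ 0}) :=
  hc.image_of_continuousOn (e.continuousOn_extend.mono (by rwa [e.extend_source]))

theorem extend_image_subset_target (hs : closure {x : M | α x ≠ 0} ⊆ e.source) :
    e.extend (QModel (n + 1)) '' closure {x : M | α x ≠ 0} ⊆
      (e.extend (QModel (n + 1))).target := by
  rintro _ ⟨x, hx, rfl⟩
  exact (e.extend (QModel (n + 1))).map_source (by rw [e.extend_source]; exact hs hx)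

/-- The domain of a chart may be disconnected, so its sign is only locally constant. That suffices
for the sign to pass through derivatives. -/
theorem signedRep_eventuallyEq (ho : IsOrientation (QModel (n + 1)) o)
    (he : e ∈ atlas (EuclideanQuadrant (n + 1)) M) {y : EuclideanSpace ℝ (Fin (n + 1))}
    (hy : y ∈ (e.extend (QModel (n + 1))).target) :
    signedRep o α e =ᶠ[𝓝[range (QModel (n + 1))] y]
      fun z => chartSign o e y • chartRep (QModel (n + 1)) e α z := by
  rw [← nhdsWithin_extend_target hy]
  filter_upwards [ho e he y hy, self_mem_nhdsWithin] with z hz hzt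
  rw [signedRep_of_mem hzt]
  simp only [chartSign, hz]

/-- The image of the support is compact, hence closed in the whole space and contained in the
target. Outside the target the extension is therefore zero in a neighbourhood. -/
theorem contDiffOn_signedRep (ho : IsOrientation (QModel (n + 1)) o)
    (hα : SmoothForm (QModel (n + 1)) α) (hc : CompactlySupported (QModel (n + 1)) α)
    (he : e ∈ atlas (EuclideanQuadrant (n + 1)) M)
    (hs : closure {x : M | α x ≠ 0} ⊆ e.source) :
    ContDiffOn ℝ ∞ (signedRep o α e) (range (QModel (n + 1))) := by
  intro y hy
  by_cases hyt : y ∈ (e.extend (QModel (n + 1))).target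
  · have h1 : ContDiffWithinAt ℝ ∞ (chartRep (QModel (n + 1)) e α) (range (QModel (n + 1))) y :=
      (hα e he y hyt).mono_of_mem_nhdsWithin (extend_target_mem_nhdsWithin_range hyt)
    have h2 := signedRep_eventuallyEq (α := α) ho he hyt
    exact (h1.const_smul (chartSign o e y)).congr_of_eventuallyEq h2 (h2.self_of_nhdsWithin hy)
  · have hyK : y ∉ e.extend (QModel (n + 1)) '' closure {x : M | α x ≠ 0} :=
      fun h => hyt (extend_image_subset_target hs h)
    have h2 : signedRep o α e =ᶠ[𝓝 y] fun _ => 0 := by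
      filter_upwards [(isCompact_extend_image hc hs).isClosed.isOpen_compl.mem_nhds hyK] with z hz
      exact signedRep_eq_zero hz
    exact (contDiffAt_const.congr_of_eventuallyEq h2).contDiffWithinAt

/-- `faceChart` needs a base point in `∂¹M`, so the case of empty `∂¹M` is treated apart; all face
domains are then empty. -/
theorem notMem_faceTarget_of_isEmpty {i : Fin (n + 1)} {u : EuclideanSpace ℝ (Fin n)}
    [IsEmpty (stratum (n + 1) M 1)] (he : e ∈ atlas (EuclideanQuadrant (n + 1)) M) :
    u ∉ faceTarget e i := fun hu =>
  isEmptyElim (⟨_, (isFaceChart_of_mem_faceTarget he hu).mem_stratum⟩ : stratum (n + 1) M 1)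

variable [IsManifold (QModel (n + 1)) ∞ M]

theorem chartDensity_extDer (ho : IsOrientation (QModel (n + 1)) o)
    (hα : SmoothForm (QModel (n + 1)) α) (he : e ∈ atlas (EuclideanQuadrant (n + 1)) M)
    {y : EuclideanSpace ℝ (Fin (n + 1))} (hy : y ∈ (e.extend (QModel (n + 1))).target) :
    chartDensity o (extDer (QModel (n + 1)) α) e y =
      extDerivWithin (signedRep o α e) (range (QModel (n + 1))) y (stdFrame (n + 1)) := by
  have hyr := extend_target_subset hy
  rw [(signedRep_eventuallyEq ho he hy).extDerivWithin_eq_of_mem hyr,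
    extDerivWithin_fun_smul _ _ ((QModel (n + 1)).uniqueDiffOn y hyr), chartDensity,
    chartRep_extDer hα he hy]
  rfl

/-- The sign from the boundary orientation is the one that the `i`-th face carries in
`stokes_quadrant`. -/
theorem chartDensity_pullback_incl {x₀ : stratum (n + 1) M 1}
    {he : e ∈ atlas (EuclideanQuadrant (n + 1)) M} {i : Fin (n + 1)}
    {u : EuclideanSpace ℝ (Fin n)} (hu : u ∈ faceTarget e i) :
    chartDensity (boundaryOrientation o) (pullback (QModel (n + 1)) (𝓡 n) (incl n M) α)
        (faceChart e i x₀ he) u =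
      (-1) ^ (i.val + 1) * signedRep o α e (faceIncl i u) fun j => faceIncl i (stdFrame n j) := by
  rw [chartDensity, chartSign_boundaryOrientation o hu, chartRep_pullback_incl α hu,
    signedRep_of_mem hu.2, mul_assoc]
  rfl

/-- In the `i`-th face chart the `i`-th coordinate is zero, whereas in any other it is positive. -/
theorem disjoint_faceChart_source (x₀ : stratum (n + 1) M 1)
    (he : e ∈ atlas (EuclideanQuadrant (n + 1)) M) :
    Pairwise (Function.onFun Disjoint fun i => (faceChart e i x₀ he).source) := by
  intro i j hij
  rw [Function.onFun, disjoint_left]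
  rintro x ⟨hx, hi⟩ ⟨-, hj⟩
  obtain ⟨l, hl⟩ := Fin.exists_succAbove_eq hij
  have h1 := hj l
  rw [hl, eq_zero_of_mem_stratum x.2 he hx hi] at h1
  exact lt_irrefl _ h1

theorem pullback_incl_eq_zero {k : ℕ} {α : DiffForm (QModel (n + 1)) M k}
    {x : stratum (n + 1) M 1} (h : α (incl n M x) = 0) :
    pullback (QModel (n + 1)) (𝓡 n) (incl n M) α x = 0 := by
  ext v
  simp only [pullback, h]
  rfl

theorem mem_iUnion_faceChart_source {x x₀ : stratum (n + 1) M 1}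
    (he : e ∈ atlas (EuclideanQuadrant (n + 1)) M) (hx : incl n M x ∈ e.source) :
    x ∈ ⋃ i, (faceChart e i x₀ he).source := by
  obtain ⟨i, hi⟩ := isFaceChart_of_mem_stratum x.2 he hx
  exact mem_iUnion.2 ⟨i, hi.mem_faceChart_source⟩

theorem pullback_incl_sum {ι : Type*} (s : Finset ι) (β : ι → DiffForm (QModel (n + 1)) M n) :
    pullback (QModel (n + 1)) (𝓡 n) (incl n M) (∑ x ∈ s, β x) =
      ∑ x ∈ s, pullback (QModel (n + 1)) (𝓡 n) (incl n M) (β x) := by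
  funext x
  ext v
  rw [Finset.sum_apply, ContinuousAlternatingMap.sum_apply]
  simp only [pullback, Finset.sum_apply]
  exact ContinuousAlternatingMap.sum_apply _ _

/-- A smooth partition of unity subordinate to the chart domains splits `α`. By local finiteness
only finitely many members meet the compact support. -/
theorem exists_smooth_decomposition [T2Space M] [SecondCountableTopology M]
    (hα : SmoothForm (QModel (n + 1)) α)
    (hc : CompactlySupported (QModel (n + 1)) α) :
    ∃ (s : Finset M) (β : M → DiffForm (QModel (n + 1)) M n),
      (∀ x, SmoothForm (QModel (n + 1)) (β x)) ∧
      (∀ x, CompactlySupported (QModel (n + 1)) (β x)) ∧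
      (∀ x, closure {z : M | β x z ≠ 0} ⊆ (chartAt (EuclideanQuadrant (n + 1)) x).source) ∧
      α = ∑ x ∈ s, β x := by
  have : LocallyCompactSpace (EuclideanQuadrant (n + 1)) := (QModel (n + 1)).locallyCompactSpace
  have : LocallyCompactSpace M := ChartedSpace.locallyCompactSpace (EuclideanQuadrant (n + 1)) M
  set K := closure {x : M | α x ≠ 0} with hK
  obtain ⟨f, hf⟩ := SmoothPartitionOfUnity.exists_isSubordinate (QModel (n + 1))
    (isClosed_closure (s := {x : M | α x ≠ 0}))
    (fun x : M => (chartAt (EuclideanQuadrant (n + 1)) x).source)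
    (fun x => (chartAt _ x).open_source)
    (fun x _ => mem_iUnion.2 ⟨x, mem_chart_source _ x⟩)
  have hfin : {x | (Function.support (f x) ∩ K).Nonempty}.Finite :=
    f.locallyFinite.finite_nonempty_inter_compact hc
  have hsupp : ∀ x, closure {z : M | f x z • α z ≠ 0} ⊆ tsupport (f x) ∩ K := by
    intro x
    refine closure_minimal ?_ ((isClosed_tsupport _).inter isClosed_closure)
    intro z hz
    refine ⟨subset_tsupport _ fun h => hz (by rw [h, zero_smul]), subset_closure fun h => hz ?_⟩
    rw [h, smul_zero]
  refine ⟨hfin.toFinset, fun x z => f x z • α z, fun x => hα.smul (f x).contMDiff,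
    fun x => hc.of_isClosed_subset isClosed_closure ((hsupp x).trans inter_subset_right),
    fun x => (hsupp x).trans (inter_subset_left.trans (hf x)), ?_⟩
  funext z
  rw [Finset.sum_apply, ← Finset.sum_smul]
  -- The partition sums to one only on `K`; elsewhere `α` vanishes.
  by_cases hz : z ∈ K
  · have h1 := f.sum_eq_one hz
    rw [finsum_eq_sum_of_support_subset (s := hfin.toFinset) _ fun x hx => ?_] at h1
    · rw [h1, one_smul]
    · simp only [Finite.coe_toFinset]
      exact ⟨z, hx, hz⟩
  · rw [eq_zero_of_notMem_closure hz, smul_zero]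

variable [MeasurableSpace M] [BorelSpace M] [SecondCountableTopology M]

/-- Stokes' theorem for a form whose support is contained in the domain of a chart. -/
theorem stokes_of_support_subset_source (ho : IsOrientation (QModel (n + 1)) o)
    (hα : SmoothForm (QModel (n + 1)) α) (hc : CompactlySupported (QModel (n + 1)) α)
    (he : e ∈ atlas (EuclideanQuadrant (n + 1)) M)
    (hs : closure {x : M | α x ≠ 0} ⊆ e.source) :
    IntegrableForm (QModel (n + 1)) o (extDer (QModel (n + 1)) α) ∧
      IntegrableForm (𝓡 n) (boundaryOrientation o)
        (pullback (QModel (n + 1)) (𝓡 n) (incl n M) α) ∧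
      formIntegral (QModel (n + 1)) o (extDer (QModel (n + 1)) α) =
        formIntegral (𝓡 n) (boundaryOrientation o)
          (pullback (QModel (n + 1)) (𝓡 n) (incl n M) α) := by
  have hK := isCompact_extend_image hc hs
  obtain ⟨hiQ, hif, hst⟩ := stokes_quadrant (contDiffOn_signedRep ho hα hc he hs) hK
    fun y hy => signedRep_eq_zero hy
  have hT : MeasurableSet (e.extend (QModel (n + 1))).target := measurableSet_extend_target
  have hEq : EqOn (fun y => extDerivWithin (signedRep o α e) (range (QModel (n + 1))) y
      (stdFrame (n + 1))) (chartDensity o (extDer (QModel (n + 1)) α) e)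
      (e.extend (QModel (n + 1))).target := fun y hy => (chartDensity_extDer ho hα he hy).symm
  have hM := integral_eq_sum_of_disjoint_charts (ι := Unit) (c := fun _ => e) ho
    (η := extDer (QModel (n + 1)) α) (fun e' he' => hα.continuousOn_chartRep_extDer he')
    (fun _ => he) (fun a b hab => absurd (Subsingleton.elim a b) hab)
    (fun x hx => extDer_eq_zero fun h => hx (mem_iUnion.2 ⟨(), hs h⟩))
    (fun _ => (hiQ.mono_set extend_target_subset).congr_fun hEq hT)
  have hMint : formIntegral (QModel (n + 1)) o (extDer (QModel (n + 1)) α) =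
      ∫ y in range (QModel (n + 1)),
        extDerivWithin (signedRep o α e) (range (QModel (n + 1))) y (stdFrame (n + 1)) := by
    rw [hM.2, Fintype.sum_unique, ← setIntegral_congr_fun hT hEq]
    refine (setIntegral_eq_of_subset_of_forall_sdiff_eq_zero
      (QModel (n + 1)).isClosed_range.measurableSet extend_target_subset ?_).symm
    rintro y ⟨-, hy⟩
    rw [extDerivWithin_eq_zero_of_notMem hK.isClosed (fun y hy => signedRep_eq_zero hy)
      fun h => hy (extend_image_subset_target hs h)]
    rfl
  have hαc : ContinuousForm α := fun e' he' => (hα e' he').continuousOn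
  rw [hMint, hst]
  refine ⟨hM.1, ?_⟩
  -- Extension by zero allows the integral over a face domain to be taken over the whole open
  -- quadrant.
  have hzero : ∀ i : Fin (n + 1), ∀ u ∈ {u : EuclideanSpace ℝ (Fin n) | ∀ j, 0 < u j} \
      faceTarget e i, signedRep o α e (faceIncl i u) (fun j => faceIncl i (stdFrame n j)) = 0 := by
    rintro i u ⟨hu, hut⟩
    rw [signedRep_of_notMem fun h => hut ⟨hu, h⟩]
    rfl
  have hpos : MeasurableSet {u : EuclideanSpace ℝ (Fin n) | ∀ j, 0 < u j} := by
    rw [← interior_range_qModel]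
    exact isOpen_interior.measurableSet
  rcases isEmpty_or_nonempty (stratum (n + 1) M 1) with hN | ⟨⟨x₀⟩⟩
  · constructor
    · have h0 : formMeasure (𝓡 n) (pullback (QModel (n + 1)) (𝓡 n) (incl n M) α) = 0 :=
        Measure.eq_zero_of_isEmpty _
      rw [IntegrableForm, h0]
      exact integrable_zero_measure
    · rw [formIntegral, integral_of_isEmpty]
      refine Finset.sum_eq_zero fun i _ => ?_
      rw [setIntegral_eq_zero_of_forall_eq_zero, mul_zero]
      exact fun u hu => hzero i u ⟨hu, notMem_faceTarget_of_isEmpty he⟩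
  · have hEq' : ∀ i : Fin (n + 1), EqOn (fun u => (-1) ^ (i.val + 1) *
        signedRep o α e (faceIncl i u) fun j => faceIncl i (stdFrame n j))
        (chartDensity (boundaryOrientation o) (pullback (QModel (n + 1)) (𝓡 n) (incl n M) α)
          (faceChart e i x₀ he)) (faceTarget e i) :=
      fun i u hu => (chartDensity_pullback_incl hu).symm
    have hfm : ∀ i, MeasurableSet (faceTarget e i) :=
      fun i => (isOpen_faceTarget x₀ he).measurableSet
    have hsub : ∀ i, faceTarget e i ⊆ {u | ∀ j, 0 < u j} := fun i u hu => hu.1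
    have hB := integral_eq_sum_of_disjoint_charts (c := fun i => faceChart e i x₀ he)
      (isOrientation_boundaryOrientation ho)
      (η := pullback (QModel (n + 1)) (𝓡 n) (incl n M) α) (continuousForm_pullback_incl hαc)
      (fun i => faceChart_mem_atlas e i x₀ he) (disjoint_faceChart_source x₀ he)
      (fun x hx => pullback_incl_eq_zero (eq_zero_of_notMem_closure fun h =>
        hx (mem_iUnion_faceChart_source he (hs h))))
      (fun i => by
        rw [faceChart_extend_target]
        exact IntegrableOn.congr_fun
          (((hif i).mono_set (hsub i)).const_mul _) (hEq' i) (hfm i))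
    refine ⟨hB.1, ?_⟩
    rw [hB.2]
    refine Finset.sum_congr rfl fun i _ => ?_
    rw [faceChart_extend_target, ← setIntegral_congr_fun (hfm i) (hEq' i), integral_const_mul,
      setIntegral_eq_of_subset_of_forall_sdiff_eq_zero hpos (hsub i) (hzero i)]

end Stokes

end CornerStokes
end

theorem proposition3p5 (n : ℕ) (M : Type*) [TopologicalSpace M] [T2Space M]
    [SecondCountableTopology M] [ConnectedSpace M] [MeasurableSpace M] [BorelSpace M]
    [ChartedSpace (EuclideanQuadrant (n + 1)) M]
    [IsManifold (CornerStokes.QModel (n + 1)) ∞ M]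
    (o : CornerStokes.PointwiseOrientation (CornerStokes.QModel (n + 1)) M)
    (ho : CornerStokes.IsOrientation (CornerStokes.QModel (n + 1)) o)
    (α : CornerStokes.DiffForm (CornerStokes.QModel (n + 1)) M n)
    (hα : CornerStokes.SmoothForm (CornerStokes.QModel (n + 1)) α)
    (hc : CornerStokes.CompactlySupported (CornerStokes.QModel (n + 1)) α) :
    CornerStokes.IntegrableForm (CornerStokes.QModel (n + 1)) o
        (CornerStokes.extDer (CornerStokes.QModel (n + 1)) α) ∧
      CornerStokes.IntegrableForm (𝓡 n) (CornerStokes.boundaryOrientation o)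
        (CornerStokes.pullback (CornerStokes.QModel (n + 1)) (𝓡 n) (CornerStokes.incl n M) α) ∧
      CornerStokes.formIntegral (CornerStokes.QModel (n + 1)) o
          (CornerStokes.extDer (CornerStokes.QModel (n + 1)) α) =
        CornerStokes.formIntegral (𝓡 n) (CornerStokes.boundaryOrientation o)
          (CornerStokes.pullback (CornerStokes.QModel (n + 1)) (𝓡 n)
            (CornerStokes.incl n M) α) := by
  obtain ⟨s, β, hβ, hβc, hβs, rfl⟩ := CornerStokes.exists_smooth_decomposition hα hc
  have key := fun x => CornerStokes.stokes_of_support_subset_source ho (hβ x) (hβc x)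
    (chart_mem_atlas _ x) (hβs x)
  -- Additivity of the integral is available for continuous forms, so continuity is recorded on both
  -- sides.
  have hd : ∀ x ∈ s, CornerStokes.ContinuousForm
      (CornerStokes.extDer (CornerStokes.QModel (n + 1)) (β x)) :=
    fun x _ e he => (hβ x).continuousOn_chartRep_extDer he
  have hp : ∀ x ∈ s, CornerStokes.ContinuousForm (CornerStokes.pullback
      (CornerStokes.QModel (n + 1)) (𝓡 n) (CornerStokes.incl n M) (β x)) :=
    fun x _ => CornerStokes.continuousForm_pullback_incl fun e he => (hβ x e he).continuousOn
  have ho' := CornerStokes.isOrientation_boundaryOrientation ho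
  rw [CornerStokes.extDer_sum s fun x _ => hβ x, CornerStokes.pullback_incl_sum]
  refine ⟨CornerStokes.integrableForm_sum ho hd fun x _ => (key x).1,
    CornerStokes.integrableForm_sum ho' hp fun x _ => (key x).2.1, ?_⟩
  rw [CornerStokes.formIntegral_sum ho hd fun x _ => (key x).1,
    CornerStokes.formIntegral_sum ho' hp fun x _ => (key x).2.1]
  exact Finset.sum_congr rfl fun x _ => (key x).2.2
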